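/- **Fermionic encodings and disparity.** Let $G$ be a finite connected graph with $M$ vertices (fermionic modes). Let $M_G$ be the group generated by the phases $\{\pm1,\pm i\}$ (central), the vertices $v_j$ and the directed edges $e_{jk}$ of $G$, subject to $e_{jk}^2=v_j^2=1$, $e_{jk}=-e_{kj}$, $\{e_{jk},v_k\}=0$, $\{e_{jk},e_{kl}\}=0$ for $j\ne l$, and all other pairs (distinct vertices; an edge and a vertex not on it; disjoint edges) commuting. Let $\mathcal C_G\le M_G$ be the group of the elements $i^{n}e_{x_0x_1}\cdots e_{x_{n-1}x_n}$ for closed walks $x_0,\dots,x_n=x_0$ in $G$. For a representation $\sigma$ of $M_G$ by Pauli operators on $N$ qubits put $S=\sigma(\mathcal C_G)$ (the stabilizer group); $\sigma$ is an encoding if $-1\notin S$. Its disparity is $\Delta:=N-M-D(S)$, where $D(S)$ is the minimal number of generators of $S$. **Kagome lattices.** In the Kagome tiling of the plane (the uniform tiling 3.6.3.6, drawn with horizontal edges) every edge is a side of one hexagon and of one triangle. A Kagome lattice is a finite nonempty subgraph $G$ of the graph of the tiling that is a union of boundaries of faces of the tiling and that contains the third side of any triangular face of which it contains two sides. Its faces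 are the faces of the tiling all of whose sides lie in $G$. It has no holes if every bounded component of the complement of $G$ in the plane is one of its faces. Let $HF$ and $TF$ be the numbers of its hexagonal and triangular faces, and $TC$ the number of its triangular corners, that is, of the vertices of $G$ that belong to exactly one face of the lattice, this face being a triangle. **The encoding.** There is one qubit for each vertex of $G$ and one for each triangular face of the lattice. Put $\sigma(v_j)=Z_j$. For an edge from $j$ to $k$, lying on the triangle $t$ of the tiling, put $\sigma(e_{jk})=\pm P_jP_kR_t$, where $P=X$ if $t$ points upwards and $P=Y$ if $t$ points downwards; the factor $R_t$ is present only if $t$ is a face of the lattice, and acts on its qubit with $R=Z,Y,X$ according as the edge is horizontal, at $60^\circ$, or at $120^\circ$ to the horizontal; the sign is $+$ if the edge is directed counterclockwise around $t$, and $-$ otherwise. This defines a representation of $M_G$. **Proposition.** For every connected Kagome lattice without holes, $-1\notin S$, so that $\sigma$ is an encoding, and its disparity is $$\Delta = HF+TC-2=\tfrac12\,(TF+TC-2).$$ -/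

import Mathlib

/-! ### Fermionic encodings on graphs -/

namespace Fermi

section Group

variable {V : Type} (G : SimpleGraph V)

/-- Generators of `M_G`: the phase `i`, the vertices, and the directed edges of `G`. -/
inductive Gen
  | phase : Gen
  | vert : V → Gen
  | edge : G.Dart → Gen

/-- The phase `i` in the free group. -/
def fI : FreeGroup (Gen G) := FreeGroup.of Gen.phase
/-- A vertex generator in the free group. -/
def fv (x : V) : FreeGroup (Gen G) := FreeGroup.of (Gen.vert x)
/-- A directed edge generator in the free group. -/
def fe (d : G.Dart) : FreeGroup (Gen G) := FreeGroup.of (Gen.edge d)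

/-- The defining relations `l = r` of `M_G`.  The phases `{1, i, -1, -i}` are the powers of a
central element `i` with `i ^ 4 = 1`, so that `-1` is `i ^ 2`. -/
inductive Rel : FreeGroup (Gen G) → FreeGroup (Gen G) → Prop
  | phase_pow : Rel (fI G ^ 4) 1
  | phase_central (x : Gen G) : Rel (fI G * FreeGroup.of x) (FreeGroup.of x * fI G)
  | vert_sq (x : V) : Rel (fv G x ^ 2) 1
  | edge_sq (d : G.Dart) : Rel (fe G d ^ 2) 1
  | edge_symm (d : G.Dart) : Rel (fe G d) (fI G ^ 2 * fe G d.symm)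
  | vert_vert (x y : V) : x ≠ y → Rel (fv G x * fv G y) (fv G y * fv G x)
  | edge_vert (d : G.Dart) (x : V) : x ≠ d.fst → x ≠ d.snd →
      Rel (fe G d * fv G x) (fv G x * fe G d)
  | edge_edge (d d' : G.Dart) : d.fst ≠ d'.fst → d.fst ≠ d'.snd → d.snd ≠ d'.fst →
      d.snd ≠ d'.snd → Rel (fe G d * fe G d') (fe G d' * fe G d)
  | edge_vert_anti (d : G.Dart) :
      Rel (fe G d * fv G d.snd) (fI G ^ 2 * (fv G d.snd * fe G d))
  | edge_edge_anti (d d' : G.Dart) : d.snd = d'.fst → d.fst ≠ d'.snd →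
      Rel (fe G d * fe G d') (fI G ^ 2 * (fe G d' * fe G d))

/-- The group `M_G` attached to a fermionic graph `G`. -/
abbrev MG : Type := PresentedGroup {w | ∃ l r, Rel G l r ∧ w = l * r⁻¹}

/-- The element of `M_G` attached to a closed walk `x₀, x₁, …, xₙ = x₀`, namely
`i ^ n * e_{x₀x₁} * ⋯ * e_{xₙ₋₁xₙ}`. -/
def cycleElt {x : V} (w : G.Walk x x) : MG G :=
  PresentedGroup.of Gen.phase ^ w.length *
    (w.darts.map fun d => PresentedGroup.of (Gen.edge d)).prod

/-- The cycle group `C_G`.  (If `G` is connected then the set of all `cycleElt w` is already closed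
under products and inverses.) -/
def cycleGroup : Subgroup (MG G) :=
  Subgroup.closure {g | ∃ (x : V) (w : G.Walk x x), g = cycleElt G w}

end Group

/-- The rank `D(S)`: the minimal size of a finite generating set of a (finitely generated)
subgroup. -/
noncomputable def minGen {X : Type} [Group X] (S : Subgroup X) : ℕ :=
  sInf {n | ∃ s : Finset X, s.card = n ∧ Subgroup.closure (s : Set X) = S}

/-- Linear operators on the Hilbert space of the qubits `Q` (for finite `Q`), written in the
computational basis, whose elements are the bit strings `Q → Fin 2`. -/
abbrev Op (Q : Type) : Type := Module.End ℂ ((Q → Fin 2) → ℂ)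

section Stabilizer

variable {V Q : Type} {G : SimpleGraph V}

/-- The stabilizer group `S = σ(C_G)`. -/
def stabilizer (σ : MG G →* (Op Q)ˣ) : Subgroup (Op Q)ˣ := (cycleGroup G).map σ

/-- The disparity `Δ = N - M - D(S)`, with `N` qubits and `M` modes. -/
noncomputable def disparity (σ : MG G →* (Op Q)ˣ) : ℤ :=
  (Nat.card Q : ℤ) - (Nat.card V : ℤ) - (minGen (stabilizer σ) : ℤ)

end Stabilizer

/-! ### Pauli operators -/

/-- The nontrivial Pauli labels. -/
inductive Pauli
  | X | Y | Z

/-- The Pauli matrices. -/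
def Pauli.mat : Pauli → Matrix (Fin 2) (Fin 2) ℂ
  | .X => !![0, 1; 1, 0]
  | .Y => !![0, -Complex.I; Complex.I, 0]
  | .Z => !![1, 0; 0, -1]

section Ops

variable {Q : Type}

open Classical in
/-- The operator acting as the matrix `A` on the qubit `q` and as the identity elsewhere. -/
noncomputable def opOn (q : Q) (A : Matrix (Fin 2) (Fin 2) ℂ) : Op Q where
  toFun ψ b := ∑ s : Fin 2, A (b q) s * ψ (Function.update b q s)
  map_add' ψ φ := by
    funext b; simp only [Fin.sum_univ_two, Pi.add_apply]; ring
  map_smul' c ψ := by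
    funext b; simp only [Fin.sum_univ_two, Pi.smul_apply, smul_eq_mul, RingHom.id_apply]; ring

theorem opOn_mul (q : Q) (A B : Matrix (Fin 2) (Fin 2) ℂ) :
    opOn q A * opOn q B = opOn q (A * B) := by
  classical
  ext1 ψ
  funext b
  simp only [opOn, Module.End.mul_apply, LinearMap.coe_mk, AddHom.coe_mk, Fin.sum_univ_two,
    Function.update_self, Function.update_idem, Matrix.mul_apply]
  ring

theorem opOn_one (q : Q) : opOn q (1 : Matrix (Fin 2) (Fin 2) ℂ) = 1 := by
  classical
  ext1 ψ
  funext b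
  have h : ∀ s : Fin 2, s = b q → Function.update b q s = b := by
    intro s hs; subst hs; simp
  simp only [opOn, LinearMap.coe_mk, AddHom.coe_mk, Module.End.one_apply, Matrix.one_apply]
  rw [Finset.sum_eq_single (b q)]
  · simp
  · intro s _ hs; simp [Ne.symm hs]
  · simp

theorem opOn_smul (q : Q) (c : ℂ) (A : Matrix (Fin 2) (Fin 2) ℂ) :
    opOn q (c • A) = c • opOn q A := by
  classical
  ext1 ψ
  funext b
  simp only [opOn, LinearMap.coe_mk, AddHom.coe_mk, Fin.sum_univ_two, LinearMap.smul_apply,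
    Pi.smul_apply, Matrix.smul_apply, smul_eq_mul]
  ring

theorem opOn_comm {q q' : Q} (h : q ≠ q') (A B : Matrix (Fin 2) (Fin 2) ℂ) :
    opOn q A * opOn q' B = opOn q' B * opOn q A := by
  classical
  ext1 ψ
  funext b
  have hu : ∀ s s' : Fin 2, Function.update (Function.update b q s) q' s' =
      Function.update (Function.update b q' s') q s := by
    intro s s'; exact Function.update_comm h s s' b
  simp only [opOn, Module.End.mul_apply, LinearMap.coe_mk, AddHom.coe_mk, Fin.sum_univ_two,
    Function.update_of_ne h, Function.update_of_ne h.symm, hu]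
  ring

theorem Pauli.mat_sq (P : Pauli) : P.mat * P.mat = 1 := by
  cases P <;> (ext i j; fin_cases i <;> fin_cases j <;> simp [Pauli.mat])

theorem Pauli.mat_anti {P P' : Pauli} (h : P ≠ P') :
    P.mat * P'.mat = (-1 : ℂ) • (P'.mat * P.mat) := by
  cases P <;> cases P' <;> first
    | exact absurd rfl h
    | (ext i j; fin_cases i <;> fin_cases j <;> simp [Pauli.mat])

theorem op_neg_smul (c : ℂ) (a : Op Q) : (-c) • a = -(c • a) := by
  ext1 ψ
  funext b
  simp

theorem op_neg_one_mul (a : Op Q) : -1 * a = -a := by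
  ext1 ψ
  funext b
  simp

/-- `a` and `b` commute up to the scalar `s`. -/
def Skew (s : ℂ) (a b : Op Q) : Prop := a * b = s • (b * a)

theorem Skew.mulRight {s t : ℂ} {a b c : Op Q} (h : Skew s a b) (k : Skew t a c) :
    Skew (s * t) a (b * c) := by
  unfold Skew at *
  rw [← mul_assoc, h, smul_mul_assoc, mul_assoc, k, mul_smul_comm, smul_smul, mul_assoc]

theorem Skew.mulLeft {s t : ℂ} {a b c : Op Q} (h : Skew s a c) (k : Skew t b c) :
    Skew (s * t) (a * b) c := by
  unfold Skew at *
  rw [mul_assoc, k, mul_smul_comm, ← mul_assoc, h, smul_mul_assoc, smul_smul, mul_assoc,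
    mul_comm t s]

theorem Skew.smulLeft {s : ℂ} {a b : Op Q} (h : Skew s a b) (c : ℂ) : Skew s (c • a) b := by
  unfold Skew at *
  rw [smul_mul_assoc, h, mul_smul_comm, smul_comm]

theorem Skew.smulRight {s : ℂ} {a b : Op Q} (h : Skew s a b) (c : ℂ) : Skew s a (c • b) := by
  unfold Skew at *
  rw [mul_smul_comm, h, smul_mul_assoc, smul_comm]

theorem skew_one_left (a : Op Q) : Skew 1 (1 : Op Q) a := by simp [Skew]

theorem skew_one_right (a : Op Q) : Skew 1 a (1 : Op Q) := by simp [Skew]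

theorem skew_self (a : Op Q) : Skew 1 a a := by simp [Skew]

theorem skew_ne {q q' : Q} (h : q ≠ q') (A B : Matrix (Fin 2) (Fin 2) ℂ) :
    Skew 1 (opOn q A) (opOn q' B) := by
  simp [Skew, opOn_comm h]

theorem skew_anti (q : Q) {P P' : Pauli} (h : P ≠ P') :
    Skew (-1) (opOn q P.mat) (opOn q P'.mat) := by
  simp only [Skew, opOn_mul, Pauli.mat_anti h, opOn_smul]

theorem opOn_sq (q : Q) (P : Pauli) : opOn q P.mat * opOn q P.mat = 1 := by
  rw [opOn_mul, P.mat_sq, opOn_one]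

/-- An involution as a unit. -/
def invol (a : Op Q) (h : a * a = 1) : (Op Q)ˣ := ⟨a, a, h, h⟩

/-- The scalar operator `i`. -/
noncomputable def opI : (Op Q)ˣ where
  val := Complex.I • 1
  inv := (-Complex.I) • 1
  val_inv := by simp [smul_smul]
  inv_val := by simp [smul_smul]

end Ops

end Fermi

/-! ### The Kagome tiling -/

namespace Kagome

/-- The pair `(a, b)` stands for the point `a (1, 0) + b (1/2, √3/2)` of the plane.  Sites of the
Kagome tiling are the points at which `a`, `b` are not both even; the points with `a`, `b` both
even are the centres of the hexagons. -/
def IsSite (p : ℤ × ℤ) : Prop := ¬ (Even p.1 ∧ Even p.2)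

/-- The differences of points at unit distance, in counterclockwise order. -/
def unitVec : Fin 6 → ℤ × ℤ := ![(1, 0), (0, 1), (-1, 1), (-1, 0), (0, -1), (1, -1)]

/-- The infinite Kagome graph: sites at unit distance are adjacent.  (Points that are not sites are
isolated.) -/
def kagome : SimpleGraph (ℤ × ℤ) where
  Adj p q := IsSite p ∧ IsSite q ∧ ∃ k, q = p + unitVec k
  symm := ⟨by
    rintro p q ⟨hp, hq, k, rfl⟩
    refine ⟨hq, hp, k + 3, ?_⟩
    fin_cases k <;> simp [unitVec, Prod.ext_iff]⟩
  loopless := ⟨by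
    rintro p ⟨-, -, k, hk⟩
    fin_cases k <;> simp [unitVec, Prod.ext_iff] at hk⟩

/-- The triangular faces of the tiling: `⟨true, m, n⟩` points upwards, `⟨false, m, n⟩` points
downwards, and both have the site `(2m+1, 2n+1)` as a corner. -/
structure Tri where
  up : Bool
  m : ℤ
  n : ℤ

/-- `1` for upward and `-1` for downward triangles. -/
def Tri.sgn (t : Tri) : ℤ := if t.up then 1 else -1

/-- The corners of a triangular face, in counterclockwise order. -/
def Tri.corner (t : Tri) : Fin 3 → ℤ × ℤ :=
  ![(2 * t.m + 1, 2 * t.n + 1), (2 * t.m + 1 + t.sgn, 2 * t.n + 1),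
    (2 * t.m + 1, 2 * t.n + 1 + t.sgn)]

/-- The corners of a triangular face. -/
def Tri.verts (t : Tri) : Set (ℤ × ℤ) := Set.range t.corner

/-- The bounded faces of the Kagome tiling; `hex m n` is the hexagon centred at `(2m, 2n)`. -/
inductive Face
  | hex : ℤ → ℤ → Face
  | tri : Tri → Face

/-- The corners of a face. -/
def Face.verts : Face → Set (ℤ × ℤ)
  | .hex m n => Set.range fun k => ((2 * m, 2 * n) : ℤ × ℤ) + unitVec k
  | .tri t => t.verts

/-- A face of the tiling is a face of the subgraph `H` if `H` contains all its sides. -/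
def HasFace (H : kagome.Subgraph) (f : Face) : Prop :=
  ∀ p ∈ f.verts, ∀ q ∈ f.verts, kagome.Adj p q → H.Adj p q

/-- A (finite) Kagome lattice: a finite union of faces of the tiling, which contains the third side
of a triangular face as soon as it contains the two others. -/
structure IsLattice (H : kagome.Subgraph) : Prop where
  finite : H.verts.Finite
  vert_face : ∀ p ∈ H.verts, ∃ f, HasFace H f ∧ p ∈ f.verts
  edge_face : ∀ p q, H.Adj p q → ∃ f, HasFace H f ∧ p ∈ f.verts ∧ q ∈ f.verts
  tri_closed : ∀ t : Tri, ∀ p ∈ t.verts, ∀ q ∈ t.verts, ∀ r ∈ t.verts,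
    p ≠ r → H.Adj p q → H.Adj q r → H.Adj p r

/-- Faces of the tiling that share a side which is not in `H`.  The components of this graph are the
connected components of the complement of `H` in the plane. -/
def dualOff (H : kagome.Subgraph) : SimpleGraph Face where
  Adj f g := f ≠ g ∧ ∃ p q, kagome.Adj p q ∧ ¬ H.Adj p q ∧
    p ∈ f.verts ∧ q ∈ f.verts ∧ p ∈ g.verts ∧ q ∈ g.verts
  symm := ⟨fun _ _ ⟨h, p, q, a, b, c, d, e, k⟩ => ⟨h.symm, p, q, a, b, e, k, c, d⟩⟩
  loopless := ⟨fun _ h => h.1 rfl⟩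

/-- `H` has no holes: a face of the tiling that is not a face of `H` lies in the unbounded component
of the complement of `H`, that is, in one that consists of infinitely many faces. -/
def NoHoles (H : kagome.Subgraph) : Prop :=
  ∀ f, ¬ HasFace H f → {g | (dualOff H).Reachable f g}.Infinite

/-- The number of hexagonal faces. -/
noncomputable def HF (H : kagome.Subgraph) : ℕ :=
  {c : ℤ × ℤ | HasFace H (.hex c.1 c.2)}.ncard

/-- The number of triangular faces. -/
noncomputable def TF (H : kagome.Subgraph) : ℕ := {t : Tri | HasFace H (.tri t)}.ncard

/-- The number of triangular corners: vertices which belong to exactly one face, a triangular one.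
(Such a vertex is on the boundary of the lattice, since four faces of the tiling meet there.) -/
noncomputable def TC (H : kagome.Subgraph) : ℕ :=
  {p ∈ H.verts | ∃ t, HasFace H (.tri t) ∧ p ∈ t.verts ∧
    ∀ f, HasFace H f → p ∈ f.verts → f = .tri t}.ncard

/-! ### Elementary facts on triangles -/

theorem Tri.mem_verts {t : Tri} {p : ℤ × ℤ} : p ∈ t.verts ↔
    (p.1 = 2 * t.m + 1 ∧ p.2 = 2 * t.n + 1) ∨
    (p.1 = 2 * t.m + 1 + t.sgn ∧ p.2 = 2 * t.n + 1) ∨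
    (p.1 = 2 * t.m + 1 ∧ p.2 = 2 * t.n + 1 + t.sgn) := by
  simp only [Tri.verts, Set.mem_range, Tri.corner]
  constructor
  · rintro ⟨k, rfl⟩
    fin_cases k <;> simp
  · rintro (h | h | h)
    · exact ⟨0, by simp [Prod.ext_iff, h.1, h.2]⟩
    · exact ⟨1, by simp [Prod.ext_iff, h.1, h.2]⟩
    · exact ⟨2, by simp [Prod.ext_iff, h.1, h.2]⟩

theorem Tri.eq_of_mem {t t' : Tri} {p : ℤ × ℤ} (h : p ∈ t.verts) (h' : p ∈ t'.verts)
    (hu : t.up = t'.up) : t = t' := by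
  rw [Tri.mem_verts] at h h'
  obtain ⟨u, m, n⟩ := t
  obtain ⟨u', m', n'⟩ := t'
  simp only at hu
  subst hu
  cases u <;> simp only [Tri.sgn, Bool.false_eq_true, if_true, if_false] at h h' <;>
    (simp only [Tri.mk.injEq, true_and]; omega)

theorem Tri.eq_of_mem₂ {t t' : Tri} {p q : ℤ × ℤ} (hpq : p ≠ q) (h : p ∈ t.verts)
    (h' : p ∈ t'.verts) (k : q ∈ t.verts) (k' : q ∈ t'.verts) : t = t' := by
  refine Tri.eq_of_mem h h' ?_
  rw [Tri.mem_verts] at h h' k k'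
  obtain ⟨u, m, n⟩ := t
  obtain ⟨u', m', n'⟩ := t'
  rw [Ne, Prod.ext_iff] at hpq
  cases u <;> cases u' <;>
    simp only [Tri.sgn, Bool.false_eq_true, if_true, if_false] at h h' k k' <;>
    first | rfl | omega

theorem exists_tri {p q : ℤ × ℤ} (h : kagome.Adj p q) :
    ∃ t : Tri, p ∈ t.verts ∧ q ∈ t.verts := by
  obtain ⟨hp, hq, k, hk⟩ := h
  have key : ∃ (u : Bool) (m n : ℤ), p ∈ (Tri.mk u m n).verts ∧ q ∈ (Tri.mk u m n).verts := by
    simp only [Tri.mem_verts, IsSite, Int.even_iff] at *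
    by_cases hu : min p.1 q.1 % 2 = 1 ∧ min p.2 q.2 % 2 = 1
    · refine ⟨true, min p.1 q.1 / 2, min p.2 q.2 / 2, ?_⟩
      fin_cases k <;> simp [unitVec, Prod.ext_iff] at hk <;> simp only [Tri.sgn, if_true] <;> omega
    · refine ⟨false, max p.1 q.1 / 2, max p.2 q.2 / 2, ?_⟩
      fin_cases k <;> simp [unitVec, Prod.ext_iff] at hk <;>
        simp only [Tri.sgn, Bool.false_eq_true, if_false] <;> omega
  obtain ⟨u, m, n, hh⟩ := key
  exact ⟨_, hh⟩

/-! ### The encoding -/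

open Fermi

instance : Nonempty Tri := ⟨⟨true, 0, 0⟩⟩

/-- The triangular face of the tiling on which the edge `pq` lies. -/
noncomputable def triOf (p q : ℤ × ℤ) : Tri :=
  Classical.epsilon fun t : Tri => p ∈ t.verts ∧ q ∈ t.verts

theorem triOf_spec {p q : ℤ × ℤ} (h : kagome.Adj p q) :
    p ∈ (triOf p q).verts ∧ q ∈ (triOf p q).verts :=
  Classical.epsilon_spec (exists_tri h)

theorem triOf_symm (p q : ℤ × ℤ) : triOf p q = triOf q p := by
  simp only [triOf, and_comm]

/-- The Pauli with which the edge operator acts on its two vertex qubits: `X` on the sides of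
upward triangles, `Y` on the sides of downward triangles. -/
noncomputable def endPauli (p q : ℤ × ℤ) : Pauli :=
  if (triOf p q).up then .X else .Y

/-- The Pauli with which the edge operator acts on the face qubit: it depends on the direction of
the edge only, so that the three sides of a triangle act with three different Paulis. -/
def facePauli (p q : ℤ × ℤ) : Pauli :=
  if p.2 = q.2 then .Z else if p.1 = q.1 then .Y else .X

open Classical in
/-- The sign of the edge operator: `1` on edges directed counterclockwise around their triangle,
and `-1` on edges directed clockwise. -/
noncomputable def edgeSign (p q : ℤ × ℤ) : ℂ :=
  if ∃ k, p = (triOf p q).corner k ∧ q = (triOf p q).corner (k + 1) then 1 else -1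

/-- The qubits: one for every vertex and one for every triangular face of the lattice. -/
abbrev Qubit (H : kagome.Subgraph) : Type := H.verts ⊕ {t : Tri // HasFace H (.tri t)}

open Classical in
/-- The action of the edge operator on the qubit of the adjacent triangular face, if that is a face
of the lattice. -/
noncomputable def faceOp (H : kagome.Subgraph) (p q : H.verts) : Op (Qubit H) :=
  if h : HasFace H (.tri (triOf p q)) then opOn (Sum.inr ⟨triOf p q, h⟩) (facePauli p q).mat else 1

/-- The encoded edge operator. -/
noncomputable def edgeOp (H : kagome.Subgraph) (p q : H.verts) : Op (Qubit H) :=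
  edgeSign p q • (opOn (Sum.inl p) (endPauli p q).mat * opOn (Sum.inl q) (endPauli p q).mat *
    faceOp H p q)

/-- The encoded vertex operator. -/
noncomputable def vertOp (H : kagome.Subgraph) (p : H.verts) : Op (Qubit H) :=
  opOn (Sum.inl p) Pauli.Z.mat

theorem edgeSign_sq (p q : ℤ × ℤ) : edgeSign p q * edgeSign p q = 1 := by
  unfold edgeSign; split_ifs <;> simp

theorem edgeSign_symm {p q : ℤ × ℤ} (h : kagome.Adj p q) : edgeSign p q = -edgeSign q p := by
  classical
  obtain ⟨hp, hq⟩ := triOf_spec h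
  have hne : p ≠ q := h.ne
  unfold edgeSign
  rw [triOf_symm q p]
  generalize triOf p q = t at *
  obtain ⟨k, rfl⟩ := hp
  obtain ⟨l, rfl⟩ := hq
  have hs : t.sgn = 1 ∨ t.sgn = -1 := by unfold Tri.sgn; split_ifs <;> simp
  have hinj : ∀ a b, t.corner a = t.corner b ↔ a = b := by
    intro a b
    refine ⟨fun hab => ?_, fun hab => by rw [hab]⟩
    fin_cases a <;> fin_cases b <;> simp [Tri.corner] at hab ⊢ <;> omega
  have hkl : k ≠ l := fun e => hne (by rw [e])
  simp only [hinj]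
  fin_cases k <;> fin_cases l <;> simp at hkl ⊢

theorem endPauli_symm (p q : ℤ × ℤ) : endPauli p q = endPauli q p := by
  unfold endPauli; rw [triOf_symm]

theorem facePauli_symm (p q : ℤ × ℤ) : facePauli p q = facePauli q p := by
  unfold facePauli; simp only [eq_comm]

theorem endPauli_ne_Z (p q : ℤ × ℤ) : endPauli p q ≠ Pauli.Z := by
  unfold endPauli; split_ifs <;> simp

theorem facePauli_ne {t : Tri} {p q r : ℤ × ℤ} (hp : p ∈ t.verts) (hq : q ∈ t.verts)
    (hr : r ∈ t.verts) (hpq : p ≠ q) (hqr : q ≠ r) (hpr : p ≠ r) :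
    facePauli p q ≠ facePauli q r := by
  have hs : t.sgn = 1 ∨ t.sgn = -1 := by unfold Tri.sgn; split_ifs <;> simp
  rw [Tri.mem_verts] at hp hq hr
  rw [Ne, Prod.ext_iff] at hpq hqr hpr
  unfold facePauli
  split_ifs <;> simp <;> omega

variable {H : kagome.Subgraph}

theorem faceOp_symm (p q : H.verts) : faceOp H p q = faceOp H q p := by
  unfold faceOp; rw [facePauli_symm, triOf_symm]

theorem faceOp_sq (p q : H.verts) : faceOp H p q * faceOp H p q = 1 := by
  unfold faceOp; split_ifs
  · exact opOn_sq _ _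
  · simp

theorem skew_inl_face (x p q : H.verts) (A : Matrix (Fin 2) (Fin 2) ℂ) :
    Skew 1 (opOn (Sum.inl x) A) (faceOp H p q) := by
  unfold faceOp; split_ifs
  · exact skew_ne (by simp) _ _
  · exact skew_one_right _

theorem skew_face_inl (x p q : H.verts) (A : Matrix (Fin 2) (Fin 2) ℂ) :
    Skew 1 (faceOp H p q) (opOn (Sum.inl x) A) := by
  unfold faceOp; split_ifs
  · exact skew_ne (by simp) _ _
  · exact skew_one_left _

theorem skew_face_face {p q p' q' : H.verts} (h : triOf p q ≠ triOf p' q') :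
    Skew 1 (faceOp H p q) (faceOp H p' q') := by
  unfold faceOp; split_ifs
  · exact skew_ne (by simpa using h) _ _
  · exact skew_one_right _
  · exact skew_one_left _
  · exact skew_one_left _

theorem skew_inl {x y : H.verts} (h : x ≠ y) (A B : Matrix (Fin 2) (Fin 2) ℂ) :
    Skew 1 (opOn (Sum.inl x : Qubit H) A) (opOn (Sum.inl y) B) :=
  skew_ne (by simpa using h) _ _

theorem skew_edge {s : ℂ} {p q : H.verts} {b : Op (Qubit H)}
    {s₁ s₂ s₃ : ℂ} (h₁ : Skew s₁ (opOn (Sum.inl p) (endPauli p q).mat) b)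
    (h₂ : Skew s₂ (opOn (Sum.inl q) (endPauli p q).mat) b) (h₃ : Skew s₃ (faceOp H p q) b)
    (hs : s₁ * s₂ * s₃ = s) : Skew s (edgeOp H p q) b :=
  hs ▸ (((h₁.mulLeft h₂).mulLeft h₃).smulLeft _)

theorem skew_edge' {s : ℂ} {p q : H.verts} {a : Op (Qubit H)}
    {s₁ s₂ s₃ : ℂ} (h₁ : Skew s₁ a (opOn (Sum.inl p) (endPauli p q).mat))
    (h₂ : Skew s₂ a (opOn (Sum.inl q) (endPauli p q).mat)) (h₃ : Skew s₃ a (faceOp H p q))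
    (hs : s₁ * s₂ * s₃ = s) : Skew s a (edgeOp H p q) :=
  hs ▸ (((h₁.mulRight h₂).mulRight h₃).smulRight _)

theorem edgeOp_symm {p q : H.verts} (h : H.Adj p q) : edgeOp H p q = -edgeOp H q p := by
  have h1 := h.adj_sub
  have hne : p ≠ q := fun e => h1.ne (by rw [e])
  have hc := skew_inl (H := H) hne (endPauli p q).mat (endPauli p q).mat
  rw [Skew, one_smul] at hc
  unfold edgeOp
  rw [edgeSign_symm h1, endPauli_symm q p, faceOp_symm q p, hc, op_neg_smul]

theorem edgeOp_sq {p q : H.verts} (h : H.Adj p q) : edgeOp H p q * edgeOp H p q = 1 := by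
  have h1 := h.adj_sub
  have hne : p ≠ q := fun e => h1.ne (by rw [e])
  have a1 := skew_inl (H := H) hne.symm (endPauli p q).mat (endPauli p q).mat
  have a2 := skew_face_inl (H := H) p p q (endPauli p q).mat
  have a3 := skew_face_inl (H := H) q p q (endPauli p q).mat
  rw [Skew, one_smul] at a1 a2 a3
  have b1 := opOn_sq (Sum.inl p : Qubit H) (endPauli p q)
  have b2 := opOn_sq (Sum.inl q : Qubit H) (endPauli p q)
  have b3 := faceOp_sq p q
  unfold edgeOp
  rw [smul_mul_smul_comm, edgeSign_sq, one_smul]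
  generalize opOn (Sum.inl p : Qubit H) (endPauli p q).mat = x at *
  generalize opOn (Sum.inl q : Qubit H) (endPauli p q).mat = y at *
  generalize faceOp H p q = z at *
  calc x * y * z * (x * y * z) = x * y * (z * x) * y * z := by simp only [mul_assoc]
    _ = x * (y * x) * (z * y) * z := by rw [a2]; simp only [mul_assoc]
    _ = (x * x) * (y * y) * (z * z) := by rw [a1, a3]; simp only [mul_assoc]
    _ = 1 := by rw [b1, b2, b3]; simp

theorem edge_vert {p q x : H.verts} (hp : x ≠ p) (hq : x ≠ q) :
    Skew 1 (edgeOp H p q) (vertOp H x) :=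
  skew_edge (skew_inl hp.symm _ _) (skew_inl hq.symm _ _) (skew_face_inl _ _ _ _) (by norm_num)

theorem edge_vert_anti {p q : H.verts} (h : p ≠ q) :
    Skew (-1) (edgeOp H p q) (vertOp H q) :=
  skew_edge (skew_inl h _ _) (skew_anti _ (endPauli_ne_Z _ _)) (skew_face_inl _ _ _ _)
    (by norm_num)

theorem edge_edge {p q r s : H.verts} (h : H.Adj p q) (h' : H.Adj r s) (h1 : p ≠ r) (h2 : p ≠ s)
    (h3 : q ≠ r) (h4 : q ≠ s) : Skew 1 (edgeOp H p q) (edgeOp H r s) := by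
  have ht : triOf p q ≠ triOf r s := by
    intro e
    obtain ⟨m1, m2⟩ := triOf_spec h.adj_sub
    obtain ⟨m3, m4⟩ := triOf_spec h'.adj_sub
    have n1 := h.adj_sub.ne
    have n2 := h'.adj_sub.ne
    rw [e] at m1 m2
    rw [Tri.mem_verts] at m1 m2 m3 m4
    rw [Ne, Subtype.ext_iff, Prod.ext_iff] at h1 h2 h3 h4
    rw [Ne, Prod.ext_iff] at n1 n2
    omega
  have aux : ∀ x : H.verts, x ≠ r → x ≠ s → ∀ A, Skew 1 (opOn (Sum.inl x) A) (edgeOp H r s) :=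
    fun x hr hs A => skew_edge' (skew_inl hr _ _) (skew_inl hs _ _) (skew_inl_face _ _ _ _)
      (by norm_num)
  exact skew_edge (aux p h1 h2 _) (aux q h3 h4 _)
    (skew_edge' (skew_face_inl _ _ _ _) (skew_face_inl _ _ _ _) (skew_face_face ht)
      (mul_one _)) (by norm_num)

theorem hasFace_of_two (hH : IsLattice H) {t : Tri} {p q r : ℤ × ℤ} (hp : p ∈ t.verts)
    (hq : q ∈ t.verts) (hr : r ∈ t.verts) (hpr : p ≠ r) (h : H.Adj p q) (h' : H.Adj q r) :
    HasFace H (.tri t) := by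
  have h3 := hH.tri_closed t p hp q hq r hr hpr h h'
  have hall : ∀ x ∈ t.verts, x = p ∨ x = q ∨ x = r := by
    have n1 := h.adj_sub.ne
    have n2 := h'.adj_sub.ne
    obtain ⟨a, rfl⟩ := hp
    obtain ⟨b, rfl⟩ := hq
    obtain ⟨c, rfl⟩ := hr
    rintro x ⟨d, rfl⟩
    have hab : a ≠ b := fun e => n1 (by rw [e])
    have hbc : b ≠ c := fun e => n2 (by rw [e])
    have hac : a ≠ c := fun e => hpr (by rw [e])
    have hd : d = a ∨ d = b ∨ d = c := by omega
    rcases hd with rfl | rfl | rfl <;> simp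
  have h1 := h.symm
  have h2 := h'.symm
  have h4 := h3.symm
  intro x hx y hy hxy
  have hne := hxy.ne
  rcases hall x hx with e | e | e <;> rcases hall y hy with e' | e' | e' <;> rw [e, e'] <;>
    first
    | exact absurd (e.trans e'.symm) hne
    | assumption

theorem edge_edge_anti (hH : IsLattice H) {p q r : H.verts} (h : H.Adj p q) (h' : H.Adj q r)
    (hpr : p ≠ r) : Skew (-1) (edgeOp H p q) (edgeOp H q r) := by
  have hpq : p ≠ q := fun e => h.adj_sub.ne (by rw [e])
  have hqr : q ≠ r := fun e => h'.adj_sub.ne (by rw [e])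
  obtain ⟨m1, m2⟩ := triOf_spec h.adj_sub
  obtain ⟨m3, m4⟩ := triOf_spec h'.adj_sub
  have aux : ∀ A, Skew 1 (opOn (Sum.inl p) A) (edgeOp H q r) :=
    fun A => skew_edge' (skew_inl hpq _ _) (skew_inl hpr _ _) (skew_inl_face _ _ _ _)
      (by norm_num)
  by_cases ht : triOf p q = triOf q r
  · have hpr' : (p : ℤ × ℤ) ≠ r := fun e => hpr (Subtype.ext e)
    have hf : HasFace H (.tri (triOf q r)) :=
      hasFace_of_two hH (ht ▸ m1) m3 m4 hpr' h h'
    have hf' : HasFace H (.tri (triOf p q)) := ht ▸ hf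
    have he : endPauli p q = endPauli q r := by unfold endPauli; rw [ht]
    have hface : Skew (-1) (faceOp H p q) (faceOp H q r) := by
      unfold faceOp
      rw [dif_pos hf, dif_pos hf']
      simp only [ht]
      exact skew_anti _ (facePauli_ne (ht ▸ m1) m3 m4 h.adj_sub.ne h'.adj_sub.ne hpr')
    refine skew_edge (aux _) (s₂ := 1) (s₃ := -1) ?_ ?_ (by norm_num)
    · rw [he]
      exact skew_edge' (skew_self _) (skew_inl hqr _ _) (skew_inl_face _ _ _ _) (by norm_num)
    · exact skew_edge' (skew_face_inl _ _ _ _) (skew_face_inl _ _ _ _) hface (by norm_num)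
  · have he : endPauli p q ≠ endPauli q r := by
      intro e
      apply ht
      refine Tri.eq_of_mem m2 m3 ?_
      unfold endPauli at e
      by_cases a : (triOf (p : ℤ × ℤ) q).up = true <;>
        by_cases b : (triOf (q : ℤ × ℤ) r).up = true <;> simp_all
    refine skew_edge (aux _) (s₂ := -1) (s₃ := 1) ?_ ?_ (by norm_num)
    · exact skew_edge' (skew_anti _ he) (skew_inl hqr _ _) (skew_inl_face _ _ _ _)
        (by norm_num)
    · exact skew_edge' (skew_face_inl _ _ _ _) (skew_face_inl _ _ _ _) (skew_face_face ht)
        (by norm_num)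

/-- The encoding on the generators of `M_G`. -/
noncomputable def genOp (H : kagome.Subgraph) : Gen H.coe → (Op (Qubit H))ˣ
  | .phase => opI
  | .vert x => invol (vertOp H x) (opOn_sq _ _)
  | .edge d => invol (edgeOp H d.fst d.snd) (edgeOp_sq d.adj)

theorem genOp_rel (hH : IsLattice H) :
    ∀ w ∈ {w | ∃ l r, Rel H.coe l r ∧ w = l * r⁻¹}, FreeGroup.lift (genOp H) w = 1 := by
  have hI : ((opI ^ 2 : (Op (Qubit H))ˣ) : Op (Qubit H)) = (-1 : ℂ) • 1 := by
    rw [Units.val_pow_eq_pow_val]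
    simp only [opI, smul_pow, Complex.I_sq, one_pow]
  rintro w ⟨l, r, hr, rfl⟩
  rw [map_mul, map_inv, mul_inv_eq_one]
  cases hr with
  | phase_pow =>
    simp only [fI, map_pow, map_one, FreeGroup.lift_apply_of, genOp]
    ext1
    rw [show (4 : ℕ) = 2 * 2 from rfl, pow_mul, Units.val_pow_eq_pow_val, hI]
    simp [smul_pow]
  | phase_central x =>
    simp only [fI, map_mul, FreeGroup.lift_apply_of, genOp]
    ext1
    simp [opI]
  | vert_sq x =>
    simp only [fv, map_pow, map_one, FreeGroup.lift_apply_of, genOp]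
    ext1
    simpa [invol, pow_two, vertOp] using opOn_sq (Sum.inl x : Qubit H) Pauli.Z
  | edge_sq d =>
    simp only [fe, map_pow, map_one, FreeGroup.lift_apply_of, genOp]
    ext1
    simpa [invol, pow_two] using edgeOp_sq d.adj
  | edge_symm d =>
    simp only [fe, fI, map_mul, map_pow, FreeGroup.lift_apply_of, genOp]
    ext1
    rw [Units.val_mul, hI, op_neg_smul, one_smul, op_neg_one_mul]
    simpa [invol] using edgeOp_symm d.adj
  | vert_vert x y h =>
    simp only [fv, map_mul, FreeGroup.lift_apply_of, genOp]
    ext1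
    simpa [invol, Skew, vertOp] using skew_inl (H := H) h Pauli.Z.mat Pauli.Z.mat
  | edge_vert d x h1 h2 =>
    simp only [fe, fv, map_mul, FreeGroup.lift_apply_of, genOp]
    ext1
    simpa [invol, Skew] using edge_vert h1 h2
  | edge_edge d d' h1 h2 h3 h4 =>
    simp only [fe, map_mul, FreeGroup.lift_apply_of, genOp]
    ext1
    simpa [invol, Skew] using edge_edge d.adj d'.adj h1 h2 h3 h4
  | edge_vert_anti d =>
    simp only [fe, fv, fI, map_mul, map_pow, FreeGroup.lift_apply_of, genOp]
    ext1
    rw [Units.val_mul, Units.val_mul, hI, op_neg_smul, one_smul, op_neg_one_mul]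
    have := edge_vert_anti (H := H) d.adj.ne
    rw [Skew, op_neg_smul, one_smul] at this
    simpa [invol] using this
  | edge_edge_anti d d' h1 h2 =>
    simp only [fe, fI, map_mul, map_pow, FreeGroup.lift_apply_of, genOp]
    ext1
    rw [Units.val_mul, Units.val_mul, hI, op_neg_smul, one_smul, op_neg_one_mul]
    have := edge_edge_anti hH d.adj (h1 ▸ d'.adj : H.Adj d.snd d'.snd) h2
    rw [Skew, op_neg_smul, one_smul] at this
    simpa [invol, h1] using this

/-- The Kagome encoding `σ : M_G → L(ℋ)`, where `G` is the lattice `H` as a fermionic graph. -/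
noncomputable def encoding (hH : IsLattice H) : MG H.coe →* (Op (Qubit H))ˣ :=
  PresentedGroup.toGroup (genOp_rel hH)

end Kagome

/-! ### Closed walks of edge operators -/

namespace Fermi

open scoped TensorProduct

/-! Both formulas are linear consequences of three facts, with `N = M + TF`: the rank of `S` is
`HF`, Euler's formula `HF + TF + V = E + 1`, and the corner count `2E + TC = 3TF + 2V`. The rank
gives `Δ = TF - HF`; eliminating `E` and `V` gives `TF + 2 = 2HF + TC`.

The structure of `S` comes from a twist. Tensor each edge operator `E p q` with `i γ_p γ_q`, where
the `γ` are anticommuting involutions (Majorana operators). The signs of the two factors cancel, so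
the twisted operators are commuting involutions, insensitive to the direction of the edge. They
define a homomorphism from the mod 2 chains of edges. Along a closed walk the `γ` telescope to `1`,
leaving the stabilizer of the walk tensored with `1`. Hence `S` is the image of the mod 2 cycle
space (`exists_cycle_hom`), and commutation with a Pauli operator can be read off from a mod 2
pairing.

The cycle space has the boundaries of the faces of the lattice as a basis. A finite cycle of the
tiling bounds a finite set of faces, by a discrete Poincaré lemma (`exists_filling`); the set is
unique because the tiling is infinite (`eq_zero_of_boundary_eq_zero`); and without holes it contains
only faces of the lattice (`exists_faces_of_cycle`). Comparison with the dimension `E - V + 1` is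
Euler's formula.

The stabilizer of a triangular face is `i^3 * XYZ = i^3 * i = 1`. Conversely, suppose that the
operator of a cycle commutes with the single-qubit operators. At a vertex, `Y` anticommutes with the
edges of the upward triangle and commutes with those of the downward one, and `X` does the opposite.
So at each corner of each triangle the cycle has both sides or neither, and is therefore a sum of
triangular faces. Thus the kernel is spanned by the triangles and `S ≅ 𝔽₂ ^ HF`. Since `-1` is
central, `-1 ∈ S` would make it the operator of a sum of triangles, which is `1`.

The corner count looks at a triangle of the tiling at one of its corners: the number of its sides
there that lie in the lattice, plus one if there are none, equals one, plus one if the triangle is a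
face (`corner_count`). -/

/-- Commuting involutions indexed by `ι` define a homomorphism from `𝔽₂ ^ ι`. -/
theorem exists_hom_of_commuting_involutions {ι Γ : Type*} [Fintype ι] [DecidableEq ι] [Group Γ]
    (U : ι → Γ) (hsq : ∀ i, U i * U i = 1) (hc : ∀ i j, U i * U j = U j * U i) :
    ∃ T : Multiplicative (ι → ZMod 2) →* Γ,
      ∀ i, T (Multiplicative.ofAdd (Pi.single i 1)) = U i := by
  classical
  have h1 : ∀ i, ∃ φ : Multiplicative (ZMod 2) →* Γ, φ (Multiplicative.ofAdd 1) = U i := by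
    intro i
    refine ⟨MonoidHom.mk' (fun x => U i ^ (x.toAdd.val)) fun x y => ?_, ?_⟩
    · have : ∀ y : ZMod 2, y = 0 ∨ y = 1 := by decide
      change U i ^ (x.toAdd + y.toAdd).val = _
      rcases this x.toAdd with h | h <;> rcases this y.toAdd with h' | h' <;> rw [h, h']
      · simp
      · simp
      · simp
      · rw [show ((1 : ZMod 2) + 1).val = 0 from rfl, show (1 : ZMod 2).val = 1 from rfl]
        simp [hsq]
    · change U i ^ (1 : ZMod 2).val = _
      rw [show (1 : ZMod 2).val = 1 from rfl, pow_one]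
  choose φ hφ using h1
  have hval : ∀ i x, φ i x = 1 ∨ φ i x = U i := by
    intro i x
    have : ∀ y : ZMod 2, y = 0 ∨ y = 1 := by decide
    rcases this x.toAdd with h | h
    · left
      rw [show x = 1 from h, map_one]
    · right
      rw [show x = Multiplicative.ofAdd 1 from h, hφ]
  have hcomm : Pairwise fun i j : ι => ∀ x y, Commute (φ i x) (φ j y) := by
    intro i j _ x y
    rcases hval i x with h | h <;> rcases hval j y with h' | h' <;> rw [h, h']
    · exact Commute.one_left _
    · exact Commute.one_right _
    · exact hc i j
  let e : Multiplicative (ι → ZMod 2) →* (ι → Multiplicative (ZMod 2)) :=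
    { toFun := fun z i => Multiplicative.ofAdd (z.toAdd i)
      map_one' := rfl
      map_mul' := fun _ _ => rfl }
  refine ⟨(MonoidHom.noncommPiCoprod φ hcomm).comp e, fun i => ?_⟩
  have he : e (Multiplicative.ofAdd (Pi.single i 1)) =
      Pi.mulSingle i (Multiplicative.ofAdd (1 : ZMod 2)) := by
    funext j
    by_cases h : j = i
    · subst h; simp [e]
    · simp [e, h]
  rw [MonoidHom.comp_apply, he, MonoidHom.noncommPiCoprod_mulSingle, hφ]

/-- Majorana operators: anticommuting involutions in a nontrivial algebra. -/
theorem exists_majorana (V : Type) [Finite V] :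
    ∃ (C : Type) (_ : Ring C) (_ : Algebra ℂ C) (_ : Nontrivial C) (γ : V → C),
      (∀ p, γ p * γ p = 1) ∧ ∀ p q, p ≠ q → γ p * γ q = -(γ q * γ p) := by
  classical
  have := Fintype.ofFinite V
  let Q := QuadraticMap.weightedSumSquares ℂ (fun _ : V => (1 : ℂ))
  have : Invertible (2 : ℂ) := invertibleOfNonzero two_ne_zero
  refine ⟨CliffordAlgebra Q, inferInstance, inferInstance, inferInstance,
    fun p => CliffordAlgebra.ι Q (Pi.single p 1), fun p => ?_, fun p q h => ?_⟩
  · rw [CliffordAlgebra.ι_sq_scalar]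
    simp [Q, QuadraticMap.weightedSumSquares_apply, Pi.single_apply]
  · apply CliffordAlgebra.ι_mul_ι_comm_of_isOrtho
    rw [QuadraticMap.isOrtho_def]
    simp only [Q, QuadraticMap.weightedSumSquares_apply, ← Finset.sum_add_distrib]
    refine Finset.sum_congr rfl fun i _ => ?_
    by_cases h1 : i = p
    · subst h1; simp [h]
    · simp [Pi.single_apply, h1]

/-- The mod 2 boundary of a set of edges with ends `src` and `tgt`. -/
noncomputable def boundary {ι V : Type} [Fintype ι] [DecidableEq V] (src tgt : ι → V) :
    (ι → ZMod 2) →ₗ[ZMod 2] (V → ZMod 2) :=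
  Fintype.linearCombination (ZMod 2) fun i => Pi.single (src i) 1 + Pi.single (tgt i) 1

/-! ### Edge operators twisted by Majorana operators. -/

section Edges

variable {V A : Type} [Ring A] [Algebra ℂ A]

/-- The commutation relations of edge operators. -/
structure EdgeRel (G : SimpleGraph V) (E : V → V → A) : Prop where
  sq : ∀ {p q}, G.Adj p q → E p q * E p q = 1
  symm : ∀ {p q}, G.Adj p q → E p q = -E q p
  comm : ∀ {p q r s}, G.Adj p q → G.Adj r s → p ≠ r → p ≠ s → q ≠ r → q ≠ s →
    E p q * E r s = E r s * E p q
  anti : ∀ {p q r}, G.Adj p q → G.Adj q r → p ≠ r → E p q * E q r = -(E q r * E p q)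

/-- The operator `i ^ n E_{x₀x₁} ⋯ E_{xₙ₋₁xₙ}` of a walk. -/
noncomputable def walkOp {G : SimpleGraph V} (E : V → V → A) {x y : V} (w : G.Walk x y) : A :=
  Complex.I ^ w.length • (w.darts.map fun d => E d.fst d.snd).prod

variable {C : Type} [Ring C] [Algebra ℂ C]

/-- An edge operator twisted by the Majorana operators of its ends. -/
noncomputable def twist (E : V → V → A) (γ : V → C) (p q : V) : A ⊗[ℂ] C :=
  E p q ⊗ₜ (Complex.I • (γ p * γ q))

variable {G : SimpleGraph V} {E : V → V → A} {γ : V → C}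

/-- Reversing an edge changes the sign of both tensor factors, so the twisted operator depends only
on the undirected edge. -/
theorem twist_symm (hE : EdgeRel G E) (hγ : ∀ p q, p ≠ q → γ p * γ q = -(γ q * γ p)) {p q : V}
    (h : G.Adj p q) : twist E γ p q = twist E γ q p := by
  unfold twist
  rw [hE.symm h, hγ p q h.ne, smul_neg, TensorProduct.neg_tmul, TensorProduct.tmul_neg, neg_neg]

/-- The bilinear `γ p * γ q` squares to `-1`; this is what the factor `i` in `twist` corrects. -/
theorem twist_sq (hE : EdgeRel G E) (h1 : ∀ p, γ p * γ p = 1)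
    (hγ : ∀ p q, p ≠ q → γ p * γ q = -(γ q * γ p)) {p q : V}
    (h : G.Adj p q) : twist E γ p q * twist E γ p q = 1 := by
  unfold twist
  rw [Algebra.TensorProduct.tmul_mul_tmul, hE.sq h, smul_mul_smul_comm, Complex.I_mul_I]
  have : γ p * γ q * (γ p * γ q) = -1 := by
    calc γ p * γ q * (γ p * γ q) = γ p * (γ q * γ p) * γ q := by simp only [mul_assoc]
      _ = -((γ p * γ p) * (γ q * γ q)) := by rw [hγ q p h.ne']; simp only [mul_assoc, neg_mul, mul_neg]
      _ = -1 := by rw [h1, h1, one_mul]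
  rw [this, neg_smul, one_smul, neg_neg, Algebra.TensorProduct.one_def]

/-- For different edges with a common vertex both tensor factors anticommute, and the two signs
cancel. -/
theorem twist_comm_adj (hE : EdgeRel G E) (h1 : ∀ p, γ p * γ p = 1)
    (hγ : ∀ p q, p ≠ q → γ p * γ q = -(γ q * γ p)) {p q r : V}
    (h : G.Adj p q) (h' : G.Adj q r) :
    twist E γ p q * twist E γ q r = twist E γ q r * twist E γ p q := by
  by_cases hpr : p = r
  · subst hpr
    rw [twist_symm hE hγ h]
  · unfold twist
    rw [Algebra.TensorProduct.tmul_mul_tmul, Algebra.TensorProduct.tmul_mul_tmul,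
      hE.anti h h' hpr, smul_mul_smul_comm, smul_mul_smul_comm]
    have e1 : γ p * γ q * (γ q * γ r) = γ p * γ r := by
      rw [mul_assoc, ← mul_assoc (γ q), h1, one_mul]
    have e2 : γ q * γ r * (γ p * γ q) = -(γ p * γ r) := by
      calc γ q * γ r * (γ p * γ q) = γ q * (γ r * γ p) * γ q := by simp only [mul_assoc]
        _ = -((γ q * γ p) * γ r * γ q) := by
          rw [hγ r p (Ne.symm hpr)]; simp only [mul_assoc, neg_mul, mul_neg]
        _ = (γ p * γ q) * (γ r * γ q) := by
          rw [hγ q p h.ne']; simp only [mul_assoc, neg_mul, neg_neg]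
        _ = -((γ p * γ q) * (γ q * γ r)) := by rw [hγ r q h'.ne', mul_neg]
        _ = -(γ p * γ r) := by rw [e1]
    rw [e1, e2, smul_neg, TensorProduct.neg_tmul, TensorProduct.tmul_neg]

theorem twist_comm (hE : EdgeRel G E) (h1 : ∀ p, γ p * γ p = 1)
    (hγ : ∀ p q, p ≠ q → γ p * γ q = -(γ q * γ p)) {p q r s : V}
    (h : G.Adj p q) (h' : G.Adj r s) :
    twist E γ p q * twist E γ r s = twist E γ r s * twist E γ p q := by
  by_cases a1 : q = r
  · subst a1; exact twist_comm_adj hE h1 hγ h h'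
  by_cases a2 : q = s
  · subst a2
    rw [twist_symm hE hγ h']
    exact twist_comm_adj hE h1 hγ h h'.symm
  by_cases a3 : p = r
  · subst a3
    rw [twist_symm hE hγ h]
    exact twist_comm_adj hE h1 hγ h.symm h'
  by_cases a4 : p = s
  · subst a4
    rw [twist_symm hE hγ h, twist_symm hE hγ h']
    exact twist_comm_adj hE h1 hγ h.symm h'.symm
  unfold twist
  rw [Algebra.TensorProduct.tmul_mul_tmul, Algebra.TensorProduct.tmul_mul_tmul,
    hE.comm h h' a3 a4 a1 a2, smul_mul_smul_comm, smul_mul_smul_comm]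
  have : γ p * γ q * (γ r * γ s) = γ r * γ s * (γ p * γ q) := by
    calc γ p * γ q * (γ r * γ s) = γ p * (γ q * γ r) * γ s := by simp only [mul_assoc]
      _ = -((γ p * γ r) * (γ q * γ s)) := by
        rw [hγ q r a1]; simp only [mul_assoc, neg_mul, mul_neg]
      _ = -(γ r * (γ p * γ s) * γ q) := by
        rw [hγ q s a2, hγ p r a3]; simp only [mul_assoc, neg_mul, mul_neg, neg_neg]
      _ = γ r * γ s * (γ p * γ q) := by
        rw [hγ p s a4]; simp only [mul_assoc, neg_mul, mul_neg]
        rw [neg_neg]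
  rw [this]

variable {ι : Type}

open Classical in
/-- The mod 2 class of an edge, in terms of the index set `ι` of the edges. -/
noncomputable def edgeClass [DecidableEq ι] (src tgt : ι → V) (e : Sym2 V) : ι → ZMod 2 :=
  if h : ∃ i, s(src i, tgt i) = e then Pi.single h.choose 1 else 0

/-- The inner Majorana operators cancel in pairs, leaving those of the two ends; the factors `i` of
the twists collect to the phase in `walkOp`. -/
theorem twist_walk (h1 : ∀ p, γ p * γ p = 1) {x y : V} (w : G.Walk x y) :
    (w.darts.map fun d => twist E γ d.fst d.snd).prod = walkOp E w ⊗ₜ[ℂ] (γ x * γ y) := by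
  induction w with
  | nil => simp [walkOp, h1, Algebra.TensorProduct.one_def]
  | @cons u v w' h p ih =>
    simp only [SimpleGraph.Walk.darts_cons, List.map_cons, List.prod_cons, ih]
    simp only [twist, walkOp, Algebra.TensorProduct.tmul_mul_tmul, SimpleGraph.Walk.length_cons,
      SimpleGraph.Walk.darts_cons, List.map_cons, List.prod_cons, pow_succ]
    have : γ u * γ v * (γ v * γ w') = γ u * γ w' := by
      rw [mul_assoc, ← mul_assoc (γ v), h1, one_mul]
    rw [smul_mul_assoc, this, mul_smul_comm, TensorProduct.tmul_smul, ← TensorProduct.smul_tmul',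
      smul_smul, ← TensorProduct.smul_tmul', mul_comm]

variable [Fintype ι] [DecidableEq ι] [DecidableEq V]

theorem boundary_edgeClass {src tgt : ι → V} {p q : V} (h : ∃ i, s(src i, tgt i) = s(p, q)) :
    boundary src tgt (edgeClass src tgt s(p, q)) = Pi.single p 1 + Pi.single q 1 := by
  unfold edgeClass
  rw [dif_pos h, boundary, Fintype.linearCombination_apply_single, one_smul]
  rcases Sym2.eq_iff.1 h.choose_spec with ⟨a, b⟩ | ⟨a, b⟩ <;> rw [a, b]
  rw [add_comm]

/-- Every inner vertex of the walk is counted twice, hence not at all mod 2. -/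
theorem boundary_walk {src tgt : ι → V} (hι : ∀ p q, G.Adj p q → ∃ i, s(src i, tgt i) = s(p, q))
    {x y : V} (w : G.Walk x y) :
    boundary src tgt (w.edges.map (edgeClass src tgt)).sum = Pi.single x 1 + Pi.single y 1 := by
  induction w with
  | nil =>
    simp only [SimpleGraph.Walk.edges_nil, List.map_nil, List.sum_nil, map_zero]
    funext i
    exact (CharTwo.add_self_eq_zero _).symm
  | @cons u v w' h p ih =>
    simp only [SimpleGraph.Walk.edges_cons, List.map_cons, List.sum_cons, map_add, ih,
      boundary_edgeClass (hι _ _ h)]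
    funext i
    have := CharTwo.add_self_eq_zero ((Pi.single v 1 : V → ZMod 2) i)
    simp only [Pi.add_apply]
    linear_combination this

end Edges

end Fermi

namespace Fermi

open scoped TensorProduct

/-! ### From mod 2 cycles to operators of closed walks. -/

section CycleHom

variable {V A ι : Type} [Ring A] [Algebra ℂ A] [Nontrivial A] [Fintype V] [DecidableEq V]
  [Fintype ι] [DecidableEq ι] {G : SimpleGraph V} {E : V → V → A} {src tgt : ι → V}

/-- The operators of closed walks form a group isomorphic to a quotient of the mod 2 cycle
space. -/
theorem exists_cycle_hom (hE : EdgeRel G E) (hG : G.Connected)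
    (hadj : ∀ i, G.Adj (src i) (tgt i))
    (hι : ∀ p q, G.Adj p q → ∃ i, s(src i, tgt i) = s(p, q)) (L : Subgroup Aˣ)
    (hL : L = Subgroup.closure {u : Aˣ | ∃ (x : V) (w : G.Walk x x), (u : A) = walkOp E w})
    (hunit : ∀ (x : V) (w : G.Walk x x), ∃ u : Aˣ, (u : A) = walkOp E w) :
    ∃ f : Multiplicative (LinearMap.ker (boundary src tgt)) →* Aˣ, f.range = L ∧
      (∀ (X : Aˣ) (c : ι → ZMod 2), (∀ i, E (src i) (tgt i) * X =
          (if c i = 0 then 1 else -1 : A) * (X * E (src i) (tgt i))) →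
        ∀ z : LinearMap.ker (boundary src tgt),
          (f (Multiplicative.ofAdd z) : A) * X = X * f (Multiplicative.ofAdd z) →
          ∑ i, z.1 i * c i = 0) ∧
      ∀ (i j k : ι), tgt i = src j → tgt j = src k → tgt k = src i →
        ∀ z : LinearMap.ker (boundary src tgt),
        z.1 = Pi.single i 1 + Pi.single j 1 + Pi.single k 1 →
        (f (Multiplicative.ofAdd z) : A) = (Complex.I ^ 3) •
          (E (src i) (tgt i) * E (src j) (tgt j) * E (src k) (tgt k)) := by
  classical
  obtain ⟨C, _, _, _, γ, h1, hγ⟩ := exists_majorana V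
  have hnt : Nontrivial (A ⊗[ℂ] C) :=
    (Algebra.TensorProduct.includeLeft_injective (R := ℂ) (S := ℂ) (A := A) (B := C)
      (algebraMap ℂ C).injective).nontrivial
  let κ : A →ₐ[ℂ] A ⊗[ℂ] C := Algebra.TensorProduct.includeLeft
  have hκ : Function.Injective κ :=
    Algebra.TensorProduct.includeLeft_injective (algebraMap ℂ C).injective
  have hκa : ∀ a, κ a = a ⊗ₜ[ℂ] (1 : C) := fun a => rfl
  let K : Aˣ →* (A ⊗[ℂ] C)ˣ := Units.map κ.toMonoidHom
  have hK : Function.Injective K := Units.map_injective hκ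
  let U : ι → (A ⊗[ℂ] C)ˣ := fun i => ⟨twist E γ (src i) (tgt i), twist E γ (src i) (tgt i),
    twist_sq hE h1 hγ (hadj i), twist_sq hE h1 hγ (hadj i)⟩
  obtain ⟨T, hT⟩ := exists_hom_of_commuting_involutions U
    (fun i => Units.ext (twist_sq hE h1 hγ (hadj i)))
    (fun i j => Units.ext (twist_comm hE h1 hγ (hadj i) (hadj j)))
  let t : (ι → ZMod 2) → A ⊗[ℂ] C := fun z => (T (Multiplicative.ofAdd z) : (A ⊗[ℂ] C)ˣ)
  have t_add : ∀ z w, t (z + w) = t z * t w := fun z w => by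
    change ((T (Multiplicative.ofAdd z * Multiplicative.ofAdd w) : (A ⊗[ℂ] C)ˣ) : A ⊗[ℂ] C) = _
    rw [map_mul]; rfl
  have t_zero : t 0 = 1 := by
    change ((T 1 : (A ⊗[ℂ] C)ˣ) : A ⊗[ℂ] C) = _
    rw [map_one]; rfl
  have t_single : ∀ i, t (Pi.single i 1) = twist E γ (src i) (tgt i) := fun i => by
    change ((T _ : (A ⊗[ℂ] C)ˣ) : A ⊗[ℂ] C) = _
    rw [hT]
  have t_edge : ∀ p q, G.Adj p q → t (edgeClass src tgt s(p, q)) = twist E γ p q := by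
    intro p q h
    unfold edgeClass
    rw [dif_pos (hι p q h), t_single]
    rcases Sym2.eq_iff.1 (hι p q h).choose_spec with ⟨a, b⟩ | ⟨a, b⟩ <;> rw [a, b]
    exact twist_symm hE hγ h.symm
  have t_walk : ∀ {x y : V} (w : G.Walk x y), t (w.edges.map (edgeClass src tgt)).sum =
      walkOp E w ⊗ₜ[ℂ] (γ x * γ y) := by
    intro x y w
    rw [← twist_walk h1]
    induction w with
    | nil => simp [t_zero]
    | @cons u v w' h p ih =>
      simp only [SimpleGraph.Walk.edges_cons, List.map_cons, List.sum_cons, t_add,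
        SimpleGraph.Walk.darts_cons, List.prod_cons, ih, t_edge _ _ h]
  have t_closed : ∀ {x : V} (w : G.Walk x x), t (w.edges.map (edgeClass src tgt)).sum =
      κ (walkOp E w) := by
    intro x w
    rw [t_walk, h1, hκa]
  -- operators of cycles come from closed walks
  have mem_L : ∀ {x : V} (w : G.Walk x x) (u : Aˣ), (u : A) = walkOp E w → u ∈ L := by
    intro x w u hu
    rw [hL]
    exact Subgroup.subset_closure ⟨x, w, hu⟩
  -- Only the operators of `z` and of the walk have to agree: nothing says that `edgeClass` picks
  -- the given index of an edge, but all indices of an edge have the same operator.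
  have walk_mem : ∀ {x : V} (w : G.Walk x x) (z : ι → ZMod 2),
      t z = t (w.edges.map (edgeClass src tgt)).sum → T (Multiplicative.ofAdd z) ∈ L.map K := by
    intro x w z hz
    obtain ⟨u, hu⟩ := hunit x w
    refine ⟨u, mem_L w u hu, Units.ext ?_⟩
    change κ (u : A) = t z
    rw [hz, t_closed, hu]
  have hmem : ∀ z ∈ LinearMap.ker (boundary src tgt),
      T (Multiplicative.ofAdd z) ∈ L.map K := by
    intro z hz
    obtain ⟨r⟩ := hG.nonempty
    have hp : ∀ x, Nonempty (G.Walk r x) := fun x => hG.preconnected r x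
    let p : ∀ x, G.Walk r x := fun x => (hp x).some
    let cl : V → (ι → ZMod 2) := fun x => ((p x).edges.map (edgeClass src tgt)).sum
    -- The loop through the base point `r` that runs along the chosen path to `src i`, through the
    -- edge `i`, and back from `tgt i`.
    have hloop : ∀ i, T (Multiplicative.ofAdd (cl (src i) + Pi.single i 1 + cl (tgt i))) ∈
        L.map K := by
      intro i
      refine walk_mem ((p (src i)).append (SimpleGraph.Walk.cons (hadj i) (p (tgt i)).reverse))
        _ ?_
      simp only [SimpleGraph.Walk.edges_append, SimpleGraph.Walk.edges_cons,
        SimpleGraph.Walk.edges_reverse, List.map_append, List.map_cons, List.map_reverse,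
        List.sum_append, List.sum_cons, List.sum_reverse, t_add, t_edge _ _ (hadj i), t_single,
        mul_assoc, cl]
    let M : AddSubgroup (ι → ZMod 2) := Subgroup.toAddSubgroup' ((L.map K).comap T)
    have hM : ∀ z, z ∈ M ↔ T (Multiplicative.ofAdd z) ∈ L.map K := fun z => Iff.rfl
    have hsum : z = ∑ i, z i • (cl (src i) + Pi.single i 1 + cl (tgt i)) := by
      -- The connecting paths cancel: their sum is the image of the boundary of `z`, which is zero,
      -- under the linear map taking each vertex to its path.
      have e1 : ∑ i, z i • (cl (src i) + cl (tgt i)) = 0 := by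
        obtain ⟨Λ, hΛ⟩ : ∃ Λ : (V → ZMod 2) →ₗ[ZMod 2] (ι → ZMod 2), ∀ x, Λ (Pi.single x 1) = cl x :=
          ⟨Fintype.linearCombination (ZMod 2) cl, fun x => by
            rw [Fintype.linearCombination_apply_single, one_smul]⟩
        have h := congrArg Λ (LinearMap.mem_ker.1 hz)
        rw [map_zero, boundary, Fintype.linearCombination_apply, map_sum] at h
        rw [← h]
        refine Finset.sum_congr rfl fun i _ => ?_
        rw [map_smul, map_add, hΛ, hΛ]
      have e2 : ∑ i, z i • (Pi.single i 1 : ι → ZMod 2) = z := by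
        funext j
        simp [Finset.sum_apply, Pi.single_apply]
      calc z = ∑ i, z i • (cl (src i) + cl (tgt i)) + ∑ i, z i • Pi.single i 1 := by
            rw [e1, e2, zero_add]
        _ = _ := by
          rw [← Finset.sum_add_distrib]
          refine Finset.sum_congr rfl fun i _ => ?_
          rw [← smul_add, add_right_comm]
    rw [← hM, hsum]
    refine sum_mem fun i _ => ?_
    have : ∀ y : ZMod 2, y = 0 ∨ y = 1 := by decide
    rcases this (z i) with h | h <;> rw [h]
    · rw [zero_smul]; exact zero_mem _
    · rw [one_smul]; exact (hM _).2 (hloop i)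
  let Tz : Multiplicative (LinearMap.ker (boundary src tgt)) →* (A ⊗[ℂ] C)ˣ :=
    T.comp (AddMonoidHom.toMultiplicative
      (LinearMap.ker (boundary src tgt)).subtype.toAddMonoidHom)
  have hTz : ∀ z, Tz z ∈ K.range := fun z => by
    obtain ⟨u, -, hu⟩ := hmem z.toAdd.1 z.toAdd.2
    exact ⟨u, hu⟩
  -- On cycles the twisted operators have the form `u ⊗ 1`, and `u ↦ u ⊗ 1` is injective, so `u` is
  -- a well-defined function of the cycle.
  let f := ((MonoidHom.ofInjective hK).symm.toMonoidHom).comp (Tz.codRestrict K.range hTz)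
  have hf : ∀ z, K (f z) = Tz z := fun z => by
    have := (MonoidHom.ofInjective hK).apply_symm_apply (Tz.codRestrict K.range hTz z)
    exact congrArg Subtype.val this
  have hft : ∀ z : LinearMap.ker (boundary src tgt),
      κ (f (Multiplicative.ofAdd z) : A) = t z.1 := fun z =>
    congrArg Units.val (hf (Multiplicative.ofAdd z))
  refine ⟨f, ?_, ?_, ?_⟩
  · apply le_antisymm
    · rintro _ ⟨z, rfl⟩
      obtain ⟨u, hu, hu'⟩ := hmem z.toAdd.1 z.toAdd.2
      have : u = f z := hK (hu'.trans (hf z).symm)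
      rwa [← this]
    · rw [hL, Subgroup.closure_le]
      rintro u ⟨x, w, hu⟩
      have hz : (w.edges.map (edgeClass src tgt)).sum ∈ LinearMap.ker (boundary src tgt) := by
        rw [LinearMap.mem_ker, boundary_walk hι]
        funext i
        exact CharTwo.add_self_eq_zero _
      refine ⟨Multiplicative.ofAdd ⟨_, hz⟩, Units.ext (hκ ?_)⟩
      rw [hft, t_closed, hu]
  · intro X c hX z hz
    -- The sign in the commutation with `X` is multiplicative in the chain, so it is given by the
    -- mod 2 pairing of `z` with `c`.
    have key : ∀ z : ι → ZMod 2, t z * κ X = (if ∑ i, z i * c i = 0 then 1 else -1) *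
        (κ X * t z) := by
      have h01 : ∀ y : ZMod 2, y = 0 ∨ y = 1 := by decide
      have h11 : (1 : ZMod 2) + 1 = 0 := rfl
      have base : ∀ i (y : ZMod 2), t (Pi.single i y) * κ X =
          (if y * c i = 0 then 1 else -1) * (κ X * t (Pi.single i y)) := by
        intro i y
        rcases h01 y with rfl | rfl
        · simp [t_zero]
        · have h := hX i
          rw [t_single, one_mul]
          unfold twist
          rw [hκa, Algebra.TensorProduct.tmul_mul_tmul, h, Algebra.TensorProduct.tmul_mul_tmul,
            mul_one, one_mul]
          split_ifs
          · rw [one_mul, one_mul]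
          · rw [neg_one_mul, neg_one_mul, TensorProduct.neg_tmul]
      have step : ∀ (z w : ι → ZMod 2) (a b : ZMod 2),
          t z * κ X = (if a = 0 then 1 else -1) * (κ X * t z) →
          t w * κ X = (if b = 0 then 1 else -1) * (κ X * t w) →
          t (z + w) * κ X = (if a + b = 0 then 1 else -1) * (κ X * t (z + w)) := by
        intro z w a b hz hw
        rw [t_add, mul_assoc, hw]
        rcases h01 a with rfl | rfl <;> rcases h01 b with rfl | rfl <;>
          simp only [if_true, zero_add, add_zero, one_ne_zero, if_false, one_mul, neg_mul,
            mul_neg, h11] at hz ⊢ <;> rw [← mul_assoc, hz] <;> simp only [mul_assoc, neg_mul, neg_neg]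
      intro z
      have hz : z = ∑ i, Pi.single i (z i) := (Finset.univ_sum_single z).symm
      have main : ∀ s : Finset ι, t (∑ i ∈ s, Pi.single i (z i)) * κ X =
          (if ∑ i ∈ s, z i * c i = 0 then 1 else -1) *
            (κ X * t (∑ i ∈ s, Pi.single i (z i))) := by
        intro s
        induction s using Finset.induction_on with
        | empty => simp [t_zero]
        | insert i s hi ih =>
          rw [Finset.sum_insert hi, Finset.sum_insert hi]
          exact step _ _ _ _ (base i (z i)) ih
      have := main Finset.univ
      rwa [← hz] at this
    by_contra hne
    have h2 := key z.1
    rw [if_neg hne, ← hft, ← map_mul, ← map_mul, hz] at h2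
    -- If the pairing were nonzero, `X` and the operator of `z` would both commute and anticommute,
    -- so twice their product would vanish although both are units.
    have h3 : ((2 : ℂ)) • κ ((X : A) * (f (Multiplicative.ofAdd z) : A)) = 0 := by
      rw [two_smul]
      nth_rw 1 [h2]
      simp
    have h4 := (smul_eq_zero.1 h3).resolve_left two_ne_zero
    have h5 : (X : A) * (f (Multiplicative.ofAdd z) : A) = 0 := hκ (by rw [h4, map_zero])
    exact (X * f (Multiplicative.ofAdd z)).ne_zero (by rw [Units.val_mul, h5])
  · intro i j k hij hjk hki z hz
    apply hκ
    rw [hft, hz, t_add, t_add, t_single, t_single, t_single]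
    simp only [twist, hij, hjk, hki, Algebra.TensorProduct.tmul_mul_tmul, smul_mul_smul_comm]
    have : γ (src i) * γ (src j) * (γ (src j) * γ (src k)) * (γ (src k) * γ (src i)) = 1 := by
      calc γ (src i) * γ (src j) * (γ (src j) * γ (src k)) * (γ (src k) * γ (src i)) =
          γ (src i) * (γ (src j) * γ (src j)) * (γ (src k) * γ (src k)) * γ (src i) := by
            simp only [mul_assoc]
        _ = 1 := by rw [h1, h1, mul_one, mul_one, h1]
    rw [this, map_smul, hκa, TensorProduct.tmul_smul, pow_succ, pow_two]

end CycleHom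

end Fermi

/-! ### Dimension of the cycle space, and rank of elementary abelian 2-groups. -/

namespace Fermi

/-- The dimension of the cycle space of a connected graph. -/
theorem finrank_ker_boundary {V ι : Type} [Fintype V] [DecidableEq V] [Fintype ι] [DecidableEq ι]
    {G : SimpleGraph V} {src tgt : ι → V} (hG : G.Connected)
    (hι : ∀ p q, G.Adj p q → ∃ i, s(src i, tgt i) = s(p, q)) :
    Module.finrank (ZMod 2) (LinearMap.ker (boundary src tgt)) + Fintype.card V =
      Fintype.card ι + 1 := by
  let σ : (V → ZMod 2) →ₗ[ZMod 2] ZMod 2 := ∑ x, LinearMap.proj x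
  have hσ : ∀ y, σ y = ∑ x, y x := fun y => by simp [σ]
  have hσ1 : ∀ x, σ (Pi.single x 1) = 1 := fun x => by
    rw [hσ]; simp
  obtain ⟨r⟩ := hG.nonempty
  -- In a connected graph the boundaries are the vertex sets of even size: such a set is a sum of
  -- pairs `{r, x}`, and each pair is the boundary of a walk.
  have hrange : LinearMap.range (boundary src tgt) = LinearMap.ker σ := by
    apply le_antisymm
    · rintro _ ⟨z, rfl⟩
      rw [LinearMap.mem_ker, boundary, Fintype.linearCombination_apply, map_sum]
      refine Finset.sum_eq_zero fun i _ => ?_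
      rw [map_smul, map_add, hσ1, hσ1]
      exact mul_zero _
    · intro y hy
      have h1 : y = ∑ x, y x • (Pi.single r 1 + Pi.single x 1 : V → ZMod 2) := by
        simp only [smul_add, Finset.sum_add_distrib, ← Finset.sum_smul]
        rw [← hσ, LinearMap.mem_ker.1 hy, zero_smul, zero_add]
        funext j
        simp [Finset.sum_apply, Pi.single_apply]
      rw [h1]
      refine sum_mem fun x _ => Submodule.smul_mem _ _ ?_
      obtain ⟨w⟩ := hG.preconnected r x
      exact ⟨_, boundary_walk hι w⟩
  have hsurj : LinearMap.range σ = ⊤ := by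
    rw [LinearMap.range_eq_top]
    exact fun c => ⟨c • Pi.single r 1, by rw [map_smul, hσ1]; simp⟩
  have e1 := LinearMap.finrank_range_add_finrank_ker (boundary src tgt)
  have e2 := LinearMap.finrank_range_add_finrank_ker σ
  rw [hsurj, finrank_top, Module.finrank_self, Module.finrank_fintype_fun_eq_card] at e2
  rw [hrange, Module.finrank_fintype_fun_eq_card] at e1
  omega

/-- The rank of an elementary abelian 2-group. -/
theorem minGen_range {Γ α : Type} [Group Γ] [Fintype α] [DecidableEq α]
    (f : Multiplicative (α → ZMod 2) →* Γ) (hf : Function.Injective f) :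
    minGen f.range = Fintype.card α := by
  classical
  apply le_antisymm
  · refine Nat.sInf_le ⟨Finset.univ.image fun i => f (Multiplicative.ofAdd (Pi.single i 1)), ?_, ?_⟩
    · rw [Finset.card_image_of_injective _ ?_, Finset.card_univ]
      intro i j hij
      by_contra h
      have h2 := congrFun (Multiplicative.ofAdd.injective (hf hij)) i
      rw [Pi.single_eq_same, Pi.single_eq_of_ne h] at h2
      exact one_ne_zero h2
    · apply le_antisymm
      · rw [Subgroup.closure_le]
        intro x hx
        obtain ⟨i, -, rfl⟩ := Finset.mem_image.1 hx
        exact ⟨_, rfl⟩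
      · rintro _ ⟨z, rfl⟩
        set M := Subgroup.closure
          ((Finset.univ.image fun i => f (Multiplicative.ofAdd (Pi.single i 1)) : Finset Γ) : Set Γ)
        let N : AddSubgroup (α → ZMod 2) := Subgroup.toAddSubgroup' (M.comap f)
        have hN : ∀ z, z ∈ N ↔ f (Multiplicative.ofAdd z) ∈ M := fun z => Iff.rfl
        change z.toAdd ∈ N
        rw [← Finset.univ_sum_single z.toAdd]
        refine sum_mem fun i _ => ?_
        have : ∀ y : ZMod 2, y = 0 ∨ y = 1 := by decide
        rcases this (z.toAdd i) with h | h <;> rw [h]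
        · rw [Pi.single_zero]; exact zero_mem _
        · rw [hN]
          exact Subgroup.subset_closure (Finset.mem_coe.2 (Finset.mem_image_of_mem _ (Finset.mem_univ i)))
  · refine le_csInf ?_ ?_
    -- The lower bound needs some finite generating set to exist, since `sInf ∅ = 0`; the whole
    -- finite range is one.
    · refine ⟨_, (Finset.univ.image f), rfl, ?_⟩
      rw [Finset.coe_image, Finset.coe_univ, Set.image_univ, ← MonoidHom.coe_range,
        Subgroup.closure_eq]
    · rintro n ⟨s, rfl, hs⟩
      let s' : Finset (α → ZMod 2) :=
        Finset.univ.filter fun z => f (Multiplicative.ofAdd z) ∈ s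
      have hs' : s'.card ≤ s.card :=
        Finset.card_le_card_of_injOn (fun z => f (Multiplicative.ofAdd z))
          (fun z hz => (Finset.mem_filter.1 hz).2)
          (fun z _ w _ h => Multiplicative.ofAdd.injective (hf h))
      -- Generators of the range pull back along the injective `f` to vectors spanning `𝔽₂ ^ α`,
      -- because a subgroup generated by vectors lies in their span.
      have htop : Submodule.span (ZMod 2) (s' : Set (α → ZMod 2)) = ⊤ := by
        rw [eq_top_iff]
        intro z _
        let N : Subgroup (Multiplicative (α → ZMod 2)) :=
          AddSubgroup.toSubgroup (Submodule.span (ZMod 2) (s' : Set (α → ZMod 2))).toAddSubgroup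
        have hle : Subgroup.closure (s : Set Γ) ≤ N.map f := by
          rw [Subgroup.closure_le]
          intro x hx
          have hx' : x ∈ f.range := hs ▸ Subgroup.subset_closure hx
          obtain ⟨w, rfl⟩ := hx'
          refine ⟨w, ?_, rfl⟩
          change w.toAdd ∈ Submodule.span (ZMod 2) (s' : Set (α → ZMod 2))
          exact Submodule.subset_span (Finset.mem_coe.2 (Finset.mem_filter.2 ⟨Finset.mem_univ _, hx⟩))
        obtain ⟨w, hw, hw'⟩ := hle (hs ▸ ⟨Multiplicative.ofAdd z, rfl⟩ :
          f (Multiplicative.ofAdd z) ∈ Subgroup.closure (s : Set Γ))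
        rw [hf hw'] at hw
        exact hw
      have := finrank_span_finset_le_card (R := ZMod 2) s'
      rw [Set.finrank, htop, finrank_top, Module.finrank_fintype_fun_eq_card] at this
      exact this.trans hs'

end Fermi

/-! ### Corners and sides of the Kagome tiling -/

namespace Kagome

theorem fin3_ne (k : Fin 3) : k + 1 ≠ k + 2 := by revert k; decide

theorem fin3_one_one (k : Fin 3) : k + 1 + 1 = k + 2 := by revert k; decide

theorem fin3_one_two (k : Fin 3) : k + 1 + 2 = k := by revert k; decide

theorem fin3_two_one (k : Fin 3) : k + 2 + 1 = k := by revert k; decide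

theorem fin3_two_two (k : Fin 3) : k + 2 + 2 = k + 1 := by revert k; decide

theorem Tri.sgn_eq (t : Tri) : t.up = true ∧ t.sgn = 1 ∨ t.up = false ∧ t.sgn = -1 := by
  unfold Tri.sgn; cases t.up <;> simp

theorem Tri.corner_zero (t : Tri) : t.corner 0 = (2 * t.m + 1, 2 * t.n + 1) := rfl
theorem Tri.corner_one (t : Tri) : t.corner 1 = (2 * t.m + 1 + t.sgn, 2 * t.n + 1) := rfl
theorem Tri.corner_two (t : Tri) : t.corner 2 = (2 * t.m + 1, 2 * t.n + 1 + t.sgn) := rfl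

theorem Tri.corner_mem (t : Tri) (a : Fin 3) : t.corner a ∈ t.verts := ⟨a, rfl⟩

theorem Tri.corner_injective (t : Tri) : Function.Injective t.corner := by
  intro a b hab
  have hs := t.sgn_eq
  fin_cases a <;> fin_cases b <;> simp [Tri.corner] at hab ⊢ <;> omega

theorem Tri.corner_isSite (t : Tri) (a : Fin 3) : IsSite (t.corner a) := by
  have hs := t.sgn_eq
  simp only [IsSite, Int.even_iff]
  fin_cases a <;> simp [Tri.corner]

set_option linter.unusedTactic false in
set_option linter.unreachableTactic false in
set_option linter.unusedSimpArgs false in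
theorem Tri.adj_corner (t : Tri) {a b : Fin 3} (h : a ≠ b) :
    kagome.Adj (t.corner a) (t.corner b) := by
  refine ⟨t.corner_isSite a, t.corner_isSite b, ?_⟩
  rcases t.sgn_eq with ⟨-, hs⟩ | ⟨-, hs⟩ <;> fin_cases a <;> fin_cases b <;>
    first
    | exact absurd rfl h
    | (refine ⟨0, ?_⟩; simp [Tri.corner, unitVec, Prod.ext_iff, hs] <;> omega)
    | (refine ⟨1, ?_⟩; simp [Tri.corner, unitVec, Prod.ext_iff, hs] <;> omega)
    | (refine ⟨2, ?_⟩; simp [Tri.corner, unitVec, Prod.ext_iff, hs] <;> omega)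
    | (refine ⟨3, ?_⟩; simp [Tri.corner, unitVec, Prod.ext_iff, hs] <;> omega)
    | (refine ⟨4, ?_⟩; simp [Tri.corner, unitVec, Prod.ext_iff, hs] <;> omega)
    | (refine ⟨5, ?_⟩; simp [Tri.corner, unitVec, Prod.ext_iff, hs] <;> omega)

/-- The triangle opposite to `t` at its corner `a`, which is again its corner number `a`. -/
def Tri.opp (t : Tri) (a : Fin 3) : Tri :=
  ⟨!t.up, t.m + (![0, t.sgn, 0] : Fin 3 → ℤ) a, t.n + (![0, 0, t.sgn] : Fin 3 → ℤ) a⟩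

theorem Tri.opp_up (t : Tri) (a : Fin 3) : (t.opp a).up = !t.up := rfl

theorem Tri.opp_ne (t : Tri) (a : Fin 3) : t.opp a ≠ t := fun h => by
  have := congrArg Tri.up h
  rw [Tri.opp_up] at this
  simp at this

theorem Tri.corner_opp (t : Tri) (a : Fin 3) : (t.opp a).corner a = t.corner a := by
  obtain ⟨u, m, n⟩ := t
  cases u <;> fin_cases a <;> simp [Tri.corner, Tri.opp, Tri.sgn] <;> ring

/-- A site lies on exactly one upward and one downward triangle, and the corner numbering is
arranged so that it has the same number in both. This is what makes all local computations at a site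
uniform in `a`. -/
theorem Tri.corner_eq_iff {t t' : Tri} {a b : Fin 3} :
    t'.corner b = t.corner a ↔ b = a ∧ (t' = t ∨ t' = t.opp a) := by
  constructor
  · intro h
    by_cases hu : t'.up = t.up
    · have : t' = t := Tri.eq_of_mem (h ▸ t'.corner_mem b) (t.corner_mem a) hu
      subst this
      exact ⟨t'.corner_injective h, Or.inl rfl⟩
    · have hu' : t'.up = (t.opp a).up := by
        rw [Tri.opp_up]; revert hu; cases t'.up <;> cases t.up <;> simp
      rw [← t.corner_opp a] at h
      have : t' = t.opp a := Tri.eq_of_mem (h ▸ t'.corner_mem b) ((t.opp a).corner_mem a) hu'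
      subst this
      exact ⟨(t.opp a).corner_injective h, Or.inr rfl⟩
  · rintro ⟨rfl, rfl | rfl⟩
    · rfl
    · exact t.corner_opp b

/-- Every site is a corner of an upward and of a downward triangle. -/
theorem exists_corner {p : ℤ × ℤ} (hp : IsSite p) (u : Bool) :
    ∃ (t : Tri) (a : Fin 3), t.up = u ∧ t.corner a = p := by
  have h : ∃ (t : Tri) (a : Fin 3), t.corner a = p := by
    simp only [IsSite, Int.even_iff] at hp
    by_cases h1 : p.1 % 2 = 0
    · exact ⟨⟨true, p.1 / 2 - 1, p.2 / 2⟩, 1, by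
        simp only [Tri.corner_one, Tri.sgn, if_true, Prod.ext_iff]; omega⟩
    · by_cases h2 : p.2 % 2 = 0
      · exact ⟨⟨true, p.1 / 2, p.2 / 2 - 1⟩, 2, by
          simp only [Tri.corner_two, Tri.sgn, if_true, Prod.ext_iff]; omega⟩
      · exact ⟨⟨true, p.1 / 2, p.2 / 2⟩, 0, by
          simp only [Tri.corner_zero, Prod.ext_iff]; omega⟩
  obtain ⟨t, a, rfl⟩ := h
  by_cases hu : t.up = u
  · exact ⟨t, a, hu, rfl⟩
  · refine ⟨t.opp a, a, ?_, t.corner_opp a⟩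
    rw [Tri.opp_up]; revert hu; cases t.up <;> cases u <;> simp

theorem fin3_cases {a b : Fin 3} (h : a ≠ b) :
    ∃ k : Fin 3, (a = k + 1 ∧ b = k + 2) ∨ (a = k + 2 ∧ b = k + 1) := by
  revert a b; decide

theorem exists_side {p q : ℤ × ℤ} (h : kagome.Adj p q) :
    ∃ (t : Tri) (k : Fin 3), s(t.corner (k + 1), t.corner (k + 2)) = s(p, q) := by
  obtain ⟨t, ⟨a, rfl⟩, ⟨b, rfl⟩⟩ := exists_tri h
  have hab : a ≠ b := fun e => h.ne (by rw [e])
  obtain ⟨k, ⟨rfl, rfl⟩ | ⟨rfl, rfl⟩⟩ := fin3_cases hab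
  · exact ⟨t, k, rfl⟩
  · exact ⟨t, k, Sym2.eq_swap⟩

/-! ### Hexagons next to the sides of triangles. -/

/-- The index of the hexagon on the other side of the side of `t` opposite to the corner `k`. -/
def Tri.hexIdx (t : Tri) (k : Fin 3) : ℤ × ℤ :=
  (t.m + (if t.up then 1 else 0) - (![0, t.sgn, 0] : Fin 3 → ℤ) k,
    t.n + (if t.up then 1 else 0) - (![0, 0, t.sgn] : Fin 3 → ℤ) k)

/-- The hexagon on the other side of the side of `t` opposite to the corner `k`. -/
def Tri.hexAt (t : Tri) (k : Fin 3) : Face := .hex (t.hexIdx k).1 (t.hexIdx k).2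

/-- Each of the two hexagons at a site lies between a side of `t` and a side of the opposite
triangle, and the numbers of these sides are exchanged. -/
theorem Tri.hexIdx_opp₁ (t : Tri) (a : Fin 3) : (t.opp a).hexIdx (a + 1) = t.hexIdx (a + 2) := by
  obtain ⟨u, m, n⟩ := t
  cases u <;> fin_cases a <;>
    simp [Tri.hexIdx, Tri.opp, Tri.sgn]

theorem Tri.hexIdx_opp₂ (t : Tri) (a : Fin 3) : (t.opp a).hexIdx (a + 2) = t.hexIdx (a + 1) := by
  obtain ⟨u, m, n⟩ := t
  cases u <;> fin_cases a <;>
    simp [Tri.hexIdx, Tri.opp, Tri.sgn]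

theorem mem_hex {m n : ℤ} {p : ℤ × ℤ} : p ∈ (Face.hex m n).verts ↔
    (p.1 = 2 * m + 1 ∧ p.2 = 2 * n) ∨ (p.1 = 2 * m ∧ p.2 = 2 * n + 1) ∨
    (p.1 = 2 * m - 1 ∧ p.2 = 2 * n + 1) ∨ (p.1 = 2 * m - 1 ∧ p.2 = 2 * n) ∨
    (p.1 = 2 * m ∧ p.2 = 2 * n - 1) ∨ (p.1 = 2 * m + 1 ∧ p.2 = 2 * n - 1) := by
  simp only [Face.verts, Set.mem_range]
  constructor
  · rintro ⟨k, rfl⟩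
    fin_cases k <;> simp [unitVec, sub_eq_add_neg]
  · rintro (h | h | h | h | h | h)
    · exact ⟨0, by simp [unitVec, Prod.ext_iff, h.1, h.2]⟩
    · exact ⟨1, by simp [unitVec, Prod.ext_iff, h.1, h.2]⟩
    · exact ⟨2, by simp [unitVec, Prod.ext_iff, h.1, h.2, sub_eq_add_neg]⟩
    · exact ⟨3, by simp [unitVec, Prod.ext_iff, h.1, h.2, sub_eq_add_neg]⟩
    · exact ⟨4, by simp [unitVec, Prod.ext_iff, h.1, h.2, sub_eq_add_neg]⟩
    · exact ⟨5, by simp [unitVec, Prod.ext_iff, h.1, h.2, sub_eq_add_neg]⟩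

theorem Tri.corner_mem_hex {t : Tri} {a : Fin 3} {m n : ℤ} :
    t.corner a ∈ (Face.hex m n).verts ↔
      (m, n) = t.hexIdx (a + 1) ∨ (m, n) = t.hexIdx (a + 2) := by
  obtain ⟨u, x, y⟩ := t
  rw [mem_hex]
  cases u <;> fin_cases a <;>
    simp [Tri.corner, Tri.hexIdx, Tri.sgn, Prod.ext_iff] <;> omega

theorem Tri.hexIdx_injective (t : Tri) : Function.Injective t.hexIdx := by
  intro a b hab
  have hs := t.sgn_eq
  fin_cases a <;> fin_cases b <;> simp [Tri.hexIdx] at hab ⊢ <;> omega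

theorem IsSite.of_mem_face {f : Face} {p : ℤ × ℤ} (h : p ∈ f.verts) : IsSite p := by
  cases f with
  | hex m n =>
    rw [mem_hex] at h
    simp only [IsSite, Int.even_iff]
    omega
  | tri t =>
    obtain ⟨a, rfl⟩ := h
    exact t.corner_isSite a

/-- The two faces at a side. -/
theorem face_eq_of_side {t : Tri} {k : Fin 3} {f : Face} (h1 : t.corner (k + 1) ∈ f.verts)
    (h2 : t.corner (k + 2) ∈ f.verts) : f = .tri t ∨ f = t.hexAt k := by
  cases f with
  | tri t' =>
    left
    have hne : t.corner (k + 1) ≠ t.corner (k + 2) := fun e => fin3_ne k (t.corner_injective e)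
    rw [Tri.eq_of_mem₂ hne h1 (t.corner_mem _) h2 (t.corner_mem _)]
  | hex m n =>
    right
    rw [Tri.corner_mem_hex] at h1 h2
    rw [fin3_one_one, fin3_one_two] at h1
    rw [fin3_two_one, fin3_two_two] at h2
    have : (m, n) = t.hexIdx k := by
      rcases h1 with h1 | h1
      · rcases h2 with h2 | h2
        · exact h2
        · exact absurd (t.hexIdx_injective (h1.symm.trans h2)).symm (fin3_ne k)
      · exact h1
    unfold Tri.hexAt
    rw [← this]

theorem side_mem_hexAt (t : Tri) (k : Fin 3) :
    t.corner (k + 1) ∈ (t.hexAt k).verts ∧ t.corner (k + 2) ∈ (t.hexAt k).verts := by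
  unfold Tri.hexAt
  rw [Tri.corner_mem_hex, Tri.corner_mem_hex]
  rw [fin3_one_two, fin3_two_one]
  exact ⟨Or.inr rfl, Or.inl rfl⟩

/-! ### Sides and faces of a subgraph. -/

/-- The side of `t` opposite to its corner `k` belongs to `H`. -/
def Side (H : kagome.Subgraph) (x : Tri × Fin 3) : Prop :=
  H.Adj (x.1.corner (x.2 + 1)) (x.1.corner (x.2 + 2))

theorem Side.of_face {H : kagome.Subgraph} {f : Face} (hf : HasFace H f) {t : Tri} {k : Fin 3}
    (h1 : t.corner (k + 1) ∈ f.verts) (h2 : t.corner (k + 2) ∈ f.verts) : Side H (t, k) :=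
  hf _ h1 _ h2 (t.adj_corner (fin3_ne k))

theorem Side.of_tri {H : kagome.Subgraph} {t : Tri} (hf : HasFace H (.tri t)) (k : Fin 3) :
    Side H (t, k) := Side.of_face hf (t.corner_mem _) (t.corner_mem _)

theorem Side.of_hex {H : kagome.Subgraph} {t : Tri} {k : Fin 3} (hf : HasFace H (t.hexAt k)) :
    Side H (t, k) := Side.of_face hf (side_mem_hexAt t k).1 (side_mem_hexAt t k).2

theorem hasFace_tri_iff {H : kagome.Subgraph} {t : Tri} :
    HasFace H (.tri t) ↔ ∀ k, Side H (t, k) := by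
  refine ⟨Side.of_tri, fun h => ?_⟩
  rintro _ ⟨a, rfl⟩ _ ⟨b, rfl⟩ hab
  have hne : a ≠ b := fun e => hab.ne (by rw [e])
  obtain ⟨k, ⟨rfl, rfl⟩ | ⟨rfl, rfl⟩⟩ := fin3_cases hne
  · exact h k
  · exact (h k).symm

theorem hasFace_of_two_sides {H : kagome.Subgraph} (hH : IsLattice H) {t : Tri} {k l : Fin 3}
    (hkl : k ≠ l) (hk : Side H (t, k)) (hl : Side H (t, l)) : HasFace H (.tri t) := by
  have key : ∀ a : Fin 3, Side H (t, a + 1) → Side H (t, a + 2) → HasFace H (.tri t) := by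
    intro a h1 h2
    unfold Side at h1 h2
    simp only [fin3_one_one, fin3_one_two, fin3_two_one, fin3_two_two] at h1 h2
    exact hasFace_of_two hH (t.corner_mem _) (t.corner_mem _) (t.corner_mem _)
      (fun e => fin3_ne a (t.corner_injective e).symm) h1 h2
  obtain ⟨a, ⟨rfl, rfl⟩ | ⟨rfl, rfl⟩⟩ := fin3_cases hkl
  · exact key a hk hl
  · exact key a hl hk

end Kagome

/-! ### The cycles of the Kagome tiling are boundaries -/

namespace Kagome

/-- A Poincaré lemma with bounded support on the square grid: `hc` says that the increments `α` (in
`m`) and `β` (in `n`) sum to zero around each unit square. The potential is obtained by summing `α`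
in from the right, where everything vanishes. -/
theorem exists_potential {α β : ℤ → ℤ → ZMod 2} {N : ℤ}
    (hα : ∀ m n, α m n ≠ 0 → |m| ≤ N ∧ |n| ≤ N) (hβ : ∀ m n, β m n ≠ 0 → |m| ≤ N ∧ |n| ≤ N)
    (hc : ∀ m n, α m n + β (m + 1) n = β m n + α m (n + 1)) :
    ∃ a : ℤ → ℤ → ZMod 2, (∀ m n, a m n ≠ 0 → |m| ≤ N ∧ |n| ≤ N) ∧
      (∀ m n, a m n = a (m + 1) n + α m n) ∧ ∀ m n, a m n = a m (n + 1) + β m n := by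
  have hα' : ∀ m n, ¬(|m| ≤ N ∧ |n| ≤ N) → α m n = 0 := fun m n h => by
    by_contra h'; exact h (hα m n h')
  have hβ' : ∀ m n, ¬(|m| ≤ N ∧ |n| ≤ N) → β m n = 0 := fun m n h => by
    by_contra h'; exact h (hβ m n h')
  have two : (2 : ZMod 2) = 0 := rfl
  let a : ℤ → ℤ → ZMod 2 := fun m n => ∑ j ∈ Finset.Ico m (N + 1), α j n
  have ha0 : ∀ m n, N < m → a m n = 0 := fun m n h => by
    simp only [a]
    rw [Finset.Ico_eq_empty (by omega), Finset.sum_empty]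
  have ha1 : ∀ m n, a m n = a (m + 1) n + α m n := by
    intro m n
    by_cases hm : N < m
    · rw [ha0 m n hm, ha0 (m + 1) n (by omega), hα' m n (fun h => by
        have := (abs_le.1 h.1).2; omega), add_zero]
    · simp only [a]
      rw [← Finset.insert_Ico_add_one_left_eq_Ico (by omega : m < N + 1),
        Finset.sum_insert (by simp), add_comm]
  have ha2 : ∀ m n, a m n = a m (n + 1) + β m n := by
    have key : ∀ (j : ℕ) (m n : ℤ), N + 1 - m ≤ j → a m n = a m (n + 1) + β m n := by
      intro j
      induction j with
      | zero =>
        intro m n h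
        rw [ha0 m n (by push_cast at h; omega), ha0 m (n + 1) (by push_cast at h; omega),
          hβ' m n (fun h' => by have := (abs_le.1 h'.1).2; push_cast at h; omega), add_zero]
      | succ j ih =>
        intro m n h
        have h1 := ih (m + 1) n (by push_cast at h; omega)
        have h2 := hc m n
        rw [ha1 m n, ha1 m (n + 1), h1]
        linear_combination h2
    exact fun m n => key (N + 1 - m).toNat m n (Int.self_le_toNat _)
  refine ⟨a, fun m n h => ?_, ha1, ha2⟩
  by_contra hmn
  apply h
  have hn0 : ∀ m n, N < |n| → a m n = 0 := fun m n hn =>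
    Finset.sum_eq_zero fun j _ => hα' j n fun h => absurd h.2 (not_le.2 hn)
  by_cases hn : N < |n|
  · exact hn0 m n hn
  by_cases hm : N < m
  · exact ha0 m n hm
  have hm' : N < |m| := by
    by_contra h'; exact hmn ⟨not_lt.1 h', not_lt.1 hn⟩
  have hcol : ∀ j : ℕ, a m n = a m (n + j) := by
    intro j
    induction j with
    | zero => simp
    | succ j ih =>
      rw [ih, ha2 m (n + j), hβ' m _ (fun h => absurd h.1 (not_le.2 hm')), add_zero]
      push_cast
      rw [add_assoc]
  have hN : |n| ≤ N := not_lt.1 hn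
  have hN0 := abs_nonneg n
  rw [hcol (2 * N + 1).toNat]
  apply hn0
  rw [Int.toNat_of_nonneg (by omega)]
  have := (abs_le.1 hN).1
  exact lt_of_lt_of_le (by omega) (le_abs_self _)

/-- A finite cycle of the tiling is the boundary of a finite set of faces. -/
theorem exists_filling {z : Tri → Fin 3 → ZMod 2} {N : ℤ}
    (hN : ∀ t k, z t k ≠ 0 → |t.m| ≤ N ∧ |t.n| ≤ N)
    (hz : ∀ t a, z t (a + 1) + z t (a + 2) + (z (t.opp a) (a + 1) + z (t.opp a) (a + 2)) = 0) :
    ∃ φ : Face → ZMod 2, φ.support.Finite ∧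
      ∀ t k, z t k = φ (.tri t) + φ (t.hexAt k) := by
  have two : (2 : ZMod 2) = 0 := rfl
  let u : ℤ → ℤ → Fin 3 → ZMod 2 := fun m n => z ⟨true, m, n⟩
  let d : ℤ → ℤ → Fin 3 → ZMod 2 := fun m n => z ⟨false, m, n⟩
  have v0 : ∀ m n, u m n 1 + u m n 2 + (d m n 1 + d m n 2) = 0 := fun m n => by
    have := hz ⟨true, m, n⟩ 0
    simpa [Tri.opp] using this
  have v1 : ∀ m n, u m n 2 + u m n 0 + (d (m + 1) n 2 + d (m + 1) n 0) = 0 := fun m n => by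
    have := hz ⟨true, m, n⟩ 1
    simpa [Tri.opp, Tri.sgn, show (1 : Fin 3) + 2 = 0 from rfl,
      show (1 : Fin 3) + 1 = 2 from rfl] using this
  have v2 : ∀ m n, u m n 0 + u m n 1 + (d m (n + 1) 0 + d m (n + 1) 1) = 0 := fun m n => by
    have := hz ⟨true, m, n⟩ 2
    simpa [Tri.opp, Tri.sgn, show (2 : Fin 3) + 2 = 1 from rfl,
      show (2 : Fin 3) + 1 = 0 from rfl] using this
  -- The potential is the filling on hexagons. Neighbouring hexagons in a row or column are
  -- separated by two sides of a downward triangle, so the value changes by the sum of `z` on those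
  -- sides. The closedness condition is the sum of the cycle conditions at the three corners of an
  -- upward triangle, whose own sides are counted twice.
  obtain ⟨a, haN, ha1, ha2⟩ := exists_potential (α := fun m n => d m n 0 + d m n 1)
    (β := fun m n => d m n 0 + d m n 2) (N := N)
    (fun m n h => by
      by_cases h0 : d m n 0 = 0
      · by_cases h1 : d m n 1 = 0
        · exact absurd (by simp [h0, h1]) h
        · exact hN _ _ h1
      · exact hN _ _ h0)
    (fun m n h => by
      by_cases h0 : d m n 0 = 0
      · by_cases h1 : d m n 2 = 0
        · exact absurd (by simp [h0, h1]) h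
        · exact hN _ _ h1
      · exact hN _ _ h0)
    (fun m n => by
      linear_combination v0 m n + v1 m n + v2 m n - (u m n 0 + u m n 1 + u m n 2 + d m n 2 +
        d m (n + 1) 0 + d m (n + 1) 1) * two)
  let φ : Face → ZMod 2
    | .hex m n => a m n
    | .tri ⟨true, m, n⟩ => u m n 0 + a (m + 1) (n + 1)
    | .tri ⟨false, m, n⟩ => d m n 0 + a m n
  refine ⟨φ, ?_, ?_⟩
  · let F : ℤ × ℤ → Set Face := fun c => {.hex c.1 c.2, .tri ⟨true, c.1, c.2⟩,
      .tri ⟨true, c.1 - 1, c.2 - 1⟩, .tri ⟨false, c.1, c.2⟩}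
    have hfin : (⋃ c ∈ (Set.Icc (-N) N ×ˢ Set.Icc (-N) N : Set (ℤ × ℤ)), F c).Finite := by
      refine Set.Finite.biUnion ((Set.finite_Icc _ _).prod (Set.finite_Icc _ _)) fun c _ => ?_
      simp [F]
    refine hfin.subset fun f hf => ?_
    have hmem : ∀ (m n : ℤ), |m| ≤ N ∧ |n| ≤ N → f ∈ F (m, n) →
        f ∈ ⋃ c ∈ (Set.Icc (-N) N ×ˢ Set.Icc (-N) N : Set (ℤ × ℤ)), F c := fun m n h h' =>
      Set.mem_biUnion (x := (m, n)) ⟨abs_le.1 h.1, abs_le.1 h.2⟩ h'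
    rw [Function.mem_support] at hf
    rcases f with ⟨m, n⟩ | ⟨_ | _, m, n⟩
    · exact hmem m n (haN m n hf) (by simp [F])
    · by_cases h0 : d m n 0 = 0
      · refine hmem m n (haN _ _ fun h => hf ?_) (by simp [F])
        simp [φ, h0, h]
      · exact hmem m n (hN _ _ h0) (by simp [F])
    · by_cases h0 : u m n 0 = 0
      · refine hmem (m + 1) (n + 1) (haN _ _ fun h => hf ?_) (by simp [F])
        simp [φ, h0, h]
      · exact hmem m n (hN _ _ h0) (by simp [F])
  · rintro ⟨up, m, n⟩ k
    have e1 := ha1 m n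
    have e2 := ha2 m n
    have e3 := ha1 m (n + 1)
    have e4 := ha2 (m + 1) n
    have w1 := v1 m n
    have w2 := v2 m n
    cases up <;> fin_cases k
    · change d m n 0 = d m n 0 + a m n + a _ _
      simp [Tri.hexIdx, Tri.sgn]
      linear_combination -(a m n) * two
    · change d m n 1 = d m n 0 + a m n + a _ _
      simp [Tri.hexIdx, Tri.sgn]
      linear_combination -e1 - (d m n 0 + a (m + 1) n) * two
    · change d m n 2 = d m n 0 + a m n + a _ _
      simp [Tri.hexIdx, Tri.sgn]
      linear_combination -e2 - (d m n 0 + a m (n + 1)) * two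
    · change u m n 0 = u m n 0 + a (m + 1) (n + 1) + a _ _
      simp [Tri.hexIdx, Tri.sgn]
      linear_combination -(a (m + 1) (n + 1)) * two
    · change u m n 1 = u m n 0 + a (m + 1) (n + 1) + a _ _
      simp [Tri.hexIdx, Tri.sgn]
      linear_combination -e3 + w2 - (u m n 0 + a (m + 1) (n + 1) + d m (n + 1) 0 + d m (n + 1) 1) * two
    · change u m n 2 = u m n 0 + a (m + 1) (n + 1) + a _ _
      simp [Tri.hexIdx, Tri.sgn]
      linear_combination -e4 + w1 - (u m n 0 + a (m + 1) (n + 1) + d (m + 1) n 0 + d (m + 1) n 2) * two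

/-- A finite set of faces without boundary is empty. -/
theorem eq_zero_of_boundary_eq_zero {φ : Face → ZMod 2} (hφ : φ.support.Finite)
    (h : ∀ t k, φ (.tri t) + φ (t.hexAt k) = 0) : φ = 0 := by
  have h1 : ∀ t k, φ (.tri t) = φ (t.hexAt k) := fun t k => by
    rw [← sub_eq_zero, CharTwo.sub_eq_add]; exact h t k
  -- Hexagons in a row are linked through downward triangles, so a nonzero value would spread over
  -- infinitely many hexagons.
  have hrow : ∀ m n (j : ℕ), φ (.hex m n) = φ (.hex (m + j) n) := by
    intro m n j
    induction j with
    | zero => simp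
    | succ j ih =>
      rw [ih]
      have h2 := (h1 ⟨false, m + j, n⟩ 0).symm.trans (h1 ⟨false, m + j, n⟩ 1)
      simpa [Tri.hexAt, Tri.hexIdx, Tri.sgn, add_assoc] using h2
  have hhex : ∀ m n, φ (.hex m n) = 0 := by
    intro m n
    by_contra hne
    refine Set.infinite_of_injective_forall_mem (f := fun j : ℕ => Face.hex (m + j) n) ?_ ?_ hφ
    · intro i j hij
      simpa using hij
    · intro j
      rw [Function.mem_support, ← hrow]
      exact hne
  have htri : ∀ t, φ (.tri t) = 0 := fun t => by rw [h1 t 0]; exact hhex _ _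
  funext f
  cases f with
  | hex m n => exact hhex m n
  | tri t => exact htri t

end Kagome

/-! ### The cycle space of a Kagome lattice -/

namespace Kagome

open Fermi

/-! ### Extension of chains by zero. -/

section Ext

variable {α : Type} {P : α → Prop}

open Classical in
/-- Extension by zero. -/
noncomputable def extZero (P : α → Prop) : ({x // P x} → ZMod 2) →ₗ[ZMod 2] (α → ZMod 2) where
  toFun φ x := if h : P x then φ ⟨x, h⟩ else 0
  map_add' φ ψ := by funext x; by_cases h : P x <;> simp [h]
  map_smul' c φ := by funext x; by_cases h : P x <;> simp [h]

theorem extZero_pos (φ : {x // P x} → ZMod 2) {x : α} (h : P x) : extZero P φ x = φ ⟨x, h⟩ :=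
  dif_pos h

theorem extZero_neg (φ : {x // P x} → ZMod 2) {x : α} (h : ¬P x) : extZero P φ x = 0 :=
  dif_neg h

theorem of_extZero_ne_zero {φ : {x // P x} → ZMod 2} {x : α} (h : extZero P φ x ≠ 0) : P x := by
  by_contra h'; exact h (extZero_neg φ h')

theorem extZero_restrict {ψ : α → ZMod 2} (h : ∀ x, ψ x ≠ 0 → P x) :
    extZero P (fun x => ψ x.1) = ψ := by
  funext x
  by_cases hx : P x
  · exact extZero_pos _ hx
  · rw [extZero_neg _ hx]
    by_contra h'
    exact hx (h x (Ne.symm h'))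

theorem extZero_injective : Function.Injective (extZero P) := by
  intro φ ψ h
  funext x
  have := congrFun h x.1
  rwa [extZero_pos _ x.2, extZero_pos _ x.2] at this

theorem sum_ite_eq_extZero [Fintype {x // P x}] [DecidableEq α] (φ : {x // P x} → ZMod 2) (x : α) :
    ∑ i : {x // P x}, φ i * (if i.1 = x then 1 else 0) = extZero P φ x := by
  classical
  by_cases h : P x
  · rw [extZero_pos φ h, Finset.sum_eq_single ⟨x, h⟩]
    · simp
    · intro i _ hi
      rw [if_neg (fun e => hi (Subtype.ext e)), mul_zero]
    · simp
  · rw [extZero_neg φ h]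
    refine Finset.sum_eq_zero fun i _ => ?_
    rw [if_neg (fun e : i.1 = x => h (e ▸ i.2)), mul_zero]

end Ext

variable {H : kagome.Subgraph}

variable (H) in
/-- The edges of the lattice, as sides of triangles of the tiling. -/
abbrev SideIdx : Type := {x : Tri × Fin 3 // Side H x}

variable (H) in
/-- The hexagonal faces of the lattice. -/
abbrev HexFace : Type := {c : ℤ × ℤ // HasFace H (.hex c.1 c.2)}

variable (H) in
/-- The triangular faces of the lattice. -/
abbrev TriFace : Type := {t : Tri // HasFace H (.tri t)}

/-- The first end of a side. -/
def SideIdx.src (i : SideIdx H) : H.verts := ⟨i.1.1.corner (i.1.2 + 1), i.2.fst_mem⟩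

/-- The second end of a side. -/
def SideIdx.tgt (i : SideIdx H) : H.verts := ⟨i.1.1.corner (i.1.2 + 2), i.2.snd_mem⟩

theorem SideIdx.adj (i : SideIdx H) : H.coe.Adj i.src i.tgt := i.2

theorem exists_sideIdx (p q : H.verts) (h : H.coe.Adj p q) :
    ∃ i : SideIdx H, s(i.src, i.tgt) = s(p, q) := by
  have h' : H.Adj p q := h
  obtain ⟨t, k, htk⟩ := exists_side h'.adj_sub
  rcases Sym2.eq_iff.1 htk with ⟨a, b⟩ | ⟨a, b⟩
  · have hs : Side H (t, k) := by
      change H.Adj (t.corner (k + 1)) (t.corner (k + 2))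
      rw [a, b]; exact h'
    exact ⟨⟨(t, k), hs⟩, Sym2.eq_iff.2 (Or.inl ⟨Subtype.ext a, Subtype.ext b⟩)⟩
  · have hs : Side H (t, k) := by
      change H.Adj (t.corner (k + 1)) (t.corner (k + 2))
      rw [a, b]; exact h'.symm
    exact ⟨⟨(t, k), hs⟩, Sym2.eq_iff.2 (Or.inr ⟨Subtype.ext a, Subtype.ext b⟩)⟩

theorem finite_sideIdx (hH : IsLattice H) : Finite (SideIdx H) := by
  have := hH.finite.to_subtype
  refine Finite.of_injective (β := H.verts × Bool) (fun i => (i.src, i.1.1.up)) ?_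
  rintro ⟨⟨t, k⟩, hi⟩ ⟨⟨t', k'⟩, hj⟩ h
  rw [Prod.ext_iff] at h
  obtain ⟨h1, h2⟩ := h
  have h3 := (Tri.corner_eq_iff (t' := t) (t := t') (b := k + 1) (a := k' + 1)).1
    (congrArg Subtype.val h1)
  have h4 : t = t' := by
    rcases h3.2 with h | h
    · exact h
    · simp only at h2
      rw [h, Tri.opp_up] at h2
      simp at h2
  have h5 : k = k' := add_right_cancel h3.1
  subst h4 h5
  rfl

theorem finite_triFace (hH : IsLattice H) : Finite (TriFace H) := by
  have := finite_sideIdx hH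
  refine Finite.of_injective (β := SideIdx H) (fun t => ⟨(t.1, 0), Side.of_tri t.2 0⟩) ?_
  intro t t' h
  exact Subtype.ext (congrArg Prod.fst (congrArg Subtype.val h))

theorem Tri.hexIdx_down (c : ℤ × ℤ) : (Tri.mk false c.1 c.2).hexIdx 0 = c := by
  simp [Tri.hexIdx]

theorem finite_hexFace (hH : IsLattice H) : Finite (HexFace H) := by
  have := finite_sideIdx hH
  refine Finite.of_injective (β := SideIdx H)
    (fun c => ⟨(Tri.mk false c.1.1 c.1.2, 0), Side.of_hex (by
      unfold Tri.hexAt; rw [Tri.hexIdx_down]; exact c.2)⟩) ?_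
  intro c c' h
  have h1 := congrArg Prod.fst (congrArg Subtype.val h)
  simp only [Tri.mk.injEq, true_and] at h1
  exact Subtype.ext (Prod.ext h1.1 h1.2)

/-- The boundary of a chain in terms of the four sides at a corner. -/
theorem boundary_corner [Fintype (SideIdx H)] [DecidableEq H.verts] (z : SideIdx H → ZMod 2)
    (t : Tri) (a : Fin 3) (hp : t.corner a ∈ H.verts) :
    boundary SideIdx.src SideIdx.tgt z ⟨t.corner a, hp⟩ =
      extZero (Side H) z (t, a + 1) + extZero (Side H) z (t, a + 2) +
      (extZero (Side H) z (t.opp a, a + 1) + extZero (Side H) z (t.opp a, a + 2)) := by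
  classical
  have hne := t.opp_ne a
  have key : ∀ i : SideIdx H, (Pi.single i.src 1 + Pi.single i.tgt 1 : H.verts → ZMod 2)
      ⟨t.corner a, hp⟩ = (if i.1 = (t, a + 1) then 1 else 0) + (if i.1 = (t, a + 2) then 1 else 0) +
        ((if i.1 = (t.opp a, a + 1) then 1 else 0) +
          (if i.1 = (t.opp a, a + 2) then 1 else 0)) := by
    rintro ⟨⟨t', k⟩, hi⟩
    have h1 : ((⟨t.corner a, hp⟩ : H.verts) = SideIdx.src ⟨(t', k), hi⟩) ↔
        k = a + 2 ∧ (t' = t ∨ t' = t.opp a) := by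
      rw [Subtype.ext_iff, eq_comm]
      change t'.corner (k + 1) = t.corner a ↔ _
      rw [Tri.corner_eq_iff]
      have : k + 1 = a ↔ k = a + 2 :=
        ⟨fun e => by rw [← e, fin3_one_two], fun e => by rw [e, fin3_two_one]⟩
      rw [this]
    have h2 : ((⟨t.corner a, hp⟩ : H.verts) = SideIdx.tgt ⟨(t', k), hi⟩) ↔
        k = a + 1 ∧ (t' = t ∨ t' = t.opp a) := by
      rw [Subtype.ext_iff, eq_comm]
      change t'.corner (k + 2) = t.corner a ↔ _
      rw [Tri.corner_eq_iff]
      have : k + 2 = a ↔ k = a + 1 :=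
        ⟨fun e => by rw [← e, fin3_two_one], fun e => by rw [e, fin3_one_two]⟩
      rw [this]
    simp only [Pi.add_apply, Pi.single_apply, h1, h2, Prod.mk.injEq]
    by_cases ht : t' = t
    · subst ht
      simp [hne.symm, add_comm]
    · by_cases ht' : t' = t.opp a
      · subst ht'
        simp [hne, add_comm]
      · simp [ht, ht']
  rw [boundary, Fintype.linearCombination_apply, Finset.sum_apply]
  simp only [Pi.smul_apply, smul_eq_mul, key, mul_add, Finset.sum_add_distrib, sum_ite_eq_extZero]

variable (H) in
/-- The boundary of a chain of hexagonal faces. -/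
noncomputable def hexBoundary : (HexFace H → ZMod 2) →ₗ[ZMod 2] (SideIdx H → ZMod 2) where
  toFun φ i := extZero (fun c : ℤ × ℤ => HasFace H (.hex c.1 c.2)) φ (i.1.1.hexIdx i.1.2)
  map_add' φ ψ := by funext i; simp
  map_smul' c φ := by funext i; simp

variable (H) in
/-- The boundary of a chain of triangular faces. -/
noncomputable def triBoundary : (TriFace H → ZMod 2) →ₗ[ZMod 2] (SideIdx H → ZMod 2) where
  toFun φ i := extZero (fun t => HasFace H (.tri t)) φ i.1.1
  map_add' φ ψ := by funext i; simp
  map_smul' c φ := by funext i; simp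

/-- Sides of a face of `H` belong to `H`, so taking boundaries in `H` and in the whole tiling gives
the same chain. -/
theorem extZero_hexBoundary (φ : HexFace H → ZMod 2) (x : Tri × Fin 3) :
    extZero (Side H) (hexBoundary H φ) x =
      extZero (fun c : ℤ × ℤ => HasFace H (.hex c.1 c.2)) φ (x.1.hexIdx x.2) := by
  by_cases hx : Side H x
  · rw [extZero_pos _ hx]; rfl
  · rw [extZero_neg _ hx, extZero_neg]
    exact fun h => hx (Side.of_hex h)

theorem extZero_triBoundary (φ : TriFace H → ZMod 2) (x : Tri × Fin 3) :
    extZero (Side H) (triBoundary H φ) x = extZero (fun t => HasFace H (.tri t)) φ x.1 := by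
  by_cases hx : Side H x
  · rw [extZero_pos _ hx]; rfl
  · rw [extZero_neg _ hx, extZero_neg]
    exact fun h => hx (Side.of_tri h _)

theorem exists_corner_of_vert (hH : IsLattice H) (p : H.verts) (u : Bool) :
    ∃ (t : Tri) (a : Fin 3), t.up = u ∧ t.corner a = p := by
  obtain ⟨f, -, hf⟩ := hH.vert_face p p.2
  exact exists_corner (IsSite.of_mem_face hf) u

/-! ### Cycles of the lattice as sums of faces. -/

section Boundary

variable [Fintype (SideIdx H)] [DecidableEq H.verts]

/-- Each of the two hexagons at a site contributes two of the four sides there. -/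
theorem hexBoundary_mem (hH : IsLattice H) (φ : HexFace H → ZMod 2) :
    hexBoundary H φ ∈ LinearMap.ker (boundary (SideIdx.src (H := H)) SideIdx.tgt) := by
  rw [LinearMap.mem_ker]
  funext p
  obtain ⟨t, a, -, h⟩ := exists_corner_of_vert hH p true
  obtain ⟨p, hp⟩ := p
  simp only at h
  subst h
  rw [boundary_corner]
  simp only [extZero_hexBoundary, Tri.hexIdx_opp₁, Tri.hexIdx_opp₂]
  rw [add_comm (extZero _ φ (t.hexIdx (a + 2)))]
  exact CharTwo.add_self_eq_zero _

theorem triBoundary_mem (hH : IsLattice H) (φ : TriFace H → ZMod 2) :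
    triBoundary H φ ∈ LinearMap.ker (boundary (SideIdx.src (H := H)) SideIdx.tgt) := by
  rw [LinearMap.mem_ker]
  funext p
  obtain ⟨t, a, -, h⟩ := exists_corner_of_vert hH p true
  obtain ⟨p, hp⟩ := p
  simp only at h
  subst h
  rw [boundary_corner]
  simp only [extZero_triBoundary, CharTwo.add_self_eq_zero]
  rfl

/-- Fill the cycle in the whole tiling. The filling does not change across a side missing from `H`,
so it is constant on each component of the complement of `H`. A face of the tiling that is not a
face of `H` lies in an infinite component, where a finitely supported filling vanishes. -/
theorem exists_faces_of_cycle (hholes : NoHoles H) {z : SideIdx H → ZMod 2}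
    (hz : z ∈ LinearMap.ker (boundary (SideIdx.src (H := H)) SideIdx.tgt)) :
    ∃ (α : HexFace H → ZMod 2) (β : TriFace H → ZMod 2),
      z = hexBoundary H α + triBoundary H β := by
  obtain ⟨N, hN⟩ : ∃ N : ℤ, ∀ i : SideIdx H, |i.1.1.m| ≤ N ∧ |i.1.1.n| ≤ N := by
    obtain ⟨N, hN⟩ := (Set.finite_range fun i : SideIdx H => max |i.1.1.m| |i.1.1.n|).bddAbove
    exact ⟨N, fun i => max_le_iff.1 (hN ⟨i, rfl⟩)⟩
  obtain ⟨φ, hφ, hz'⟩ := exists_filling (z := fun t k => extZero (Side H) z (t, k)) (N := N)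
    (fun t k h => hN ⟨(t, k), of_extZero_ne_zero h⟩) (fun t a => by
      by_cases hp : t.corner a ∈ H.verts
      · rw [← boundary_corner z t a hp, LinearMap.mem_ker.1 hz]; rfl
      -- At a site outside `H` none of the four sides belongs to `H`.
      · have h1 : ∀ t' : Tri, t'.corner a = t.corner a →
            ¬Side H (t', a + 1) ∧ ¬Side H (t', a + 2) := by
          intro t' ht'
          constructor
          · intro h
            have h := h.snd_mem
            simp only [fin3_one_two, ht'] at h
            exact hp h
          · intro h
            have h := h.fst_mem
            simp only [fin3_two_one, ht'] at h
            exact hp h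
        rw [extZero_neg _ (h1 t rfl).1, extZero_neg _ (h1 t rfl).2,
          extZero_neg _ (h1 _ (t.corner_opp a)).1, extZero_neg _ (h1 _ (t.corner_opp a)).2]
        rfl)
  have hadj : ∀ f g, (dualOff H).Adj f g → φ f = φ g := by
    rintro f g ⟨hfg, p, q, hpq, hn, hpf, hqf, hpg, hqg⟩
    obtain ⟨t, k, htk⟩ := exists_side hpq
    have hs : ¬Side H (t, k) ∧ (t.corner (k + 1) ∈ f.verts ∧ t.corner (k + 2) ∈ f.verts) ∧
        t.corner (k + 1) ∈ g.verts ∧ t.corner (k + 2) ∈ g.verts := by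
      unfold Side
      rcases Sym2.eq_iff.1 htk with ⟨a, b⟩ | ⟨a, b⟩
      · simp only [a, b]; exact ⟨hn, ⟨hpf, hqf⟩, hpg, hqg⟩
      · simp only [a, b]; exact ⟨fun h => hn h.symm, ⟨hqf, hpf⟩, hqg, hpg⟩
    have h0 := hz' t k
    rw [extZero_neg _ hs.1] at h0
    have h1 : φ (.tri t) = φ (t.hexAt k) := by
      rw [← sub_eq_zero, CharTwo.sub_eq_add]; exact h0.symm
    rcases face_eq_of_side hs.2.1.1 hs.2.1.2 with rfl | rfl <;>
      rcases face_eq_of_side hs.2.2.1 hs.2.2.2 with rfl | rfl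
    · rfl
    · exact h1
    · exact h1.symm
    · rfl
  have hreach : ∀ f g, (dualOff H).Reachable f g → φ f = φ g := by
    rintro f g ⟨w⟩
    induction w with
    | nil => rfl
    | cons h _ ih => exact (hadj _ _ h).trans ih
  have hface : ∀ f, φ f ≠ 0 → HasFace H f := by
    intro f hf
    by_contra hn
    refine hholes f hn (hφ.subset fun g hg => ?_)
    rw [Function.mem_support, ← hreach f g hg]
    exact hf
  refine ⟨fun c => φ (.hex c.1.1 c.1.2), fun t => φ (.tri t.1), ?_⟩
  funext i
  have e1 := hz' i.1.1 i.1.2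
  have e2 := congrFun (extZero_restrict (P := fun c : ℤ × ℤ => HasFace H (.hex c.1 c.2))
    (ψ := fun c => φ (.hex c.1 c.2)) fun c hc => hface _ hc) (i.1.1.hexIdx i.1.2)
  have e3 := congrFun (extZero_restrict (P := fun t : Tri => HasFace H (.tri t))
    (ψ := fun t => φ (.tri t)) fun c hc => hface _ hc) i.1.1
  rw [extZero_pos _ i.2] at e1
  calc z i = φ (i.1.1.hexAt i.1.2) + φ (.tri i.1.1) := by rw [add_comm]; exact e1
    _ = _ := congrArg₂ (· + ·) e2.symm e3.symm

end Boundary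

theorem eq_zero_of_faces (hH : IsLattice H) {α : HexFace H → ZMod 2} {β : TriFace H → ZMod 2}
    (h : hexBoundary H α + triBoundary H β = 0) : α = 0 ∧ β = 0 := by
  have := finite_hexFace hH
  have := finite_triFace hH
  let φ : Face → ZMod 2
    | .hex m n => extZero (fun c : ℤ × ℤ => HasFace H (.hex c.1 c.2)) α (m, n)
    | .tri t => extZero (fun t => HasFace H (.tri t)) β t
  have hφ : φ.support.Finite := by
    refine ((Set.finite_range fun c : HexFace H => Face.hex c.1.1 c.1.2).union
      (Set.finite_range fun t : TriFace H => Face.tri t.1)).subset fun f hf => ?_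
    cases f with
    | hex m n => exact Or.inl ⟨⟨(m, n), of_extZero_ne_zero (x := (m, n)) hf⟩, rfl⟩
    | tri t => exact Or.inr ⟨⟨t, of_extZero_ne_zero (x := t) hf⟩, rfl⟩
  have h0 := eq_zero_of_boundary_eq_zero hφ (fun t k => by
    have h1 := congrFun (congrArg (extZero (Side H)) h) (t, k)
    rw [map_add, map_zero, Pi.add_apply, extZero_hexBoundary, extZero_triBoundary, add_comm] at h1
    exact h1)
  constructor
  · apply extZero_injective
    rw [map_zero]
    funext c
    exact congrFun h0 (.hex c.1 c.2)
  · apply extZero_injective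
    rw [map_zero]
    funext t
    exact congrFun h0 (.tri t)

/-- Euler's formula. -/
theorem euler (hH : IsLattice H) (hconn : H.Connected) (hholes : NoHoles H) :
    HF H + TF H + Nat.card H.verts = Nat.card (SideIdx H) + 1 := by
  classical
  have := hH.finite.to_subtype
  have := finite_sideIdx hH
  have := finite_hexFace hH
  have := finite_triFace hH
  have := Fintype.ofFinite H.verts
  have := Fintype.ofFinite (SideIdx H)
  have := Fintype.ofFinite (HexFace H)
  have := Fintype.ofFinite (TriFace H)
  have h1 := finrank_ker_boundary (src := SideIdx.src (H := H)) (tgt := SideIdx.tgt) hconn.coe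
    exists_sideIdx
  -- The face boundaries form a basis of the cycle space: `D` is injective with the cycle space as
  -- its range.
  let D : ((HexFace H → ZMod 2) × (TriFace H → ZMod 2)) →ₗ[ZMod 2] (SideIdx H → ZMod 2) :=
    (hexBoundary H).coprod (triBoundary H)
  have hD : Function.Injective D := by
    rw [← LinearMap.ker_eq_bot, LinearMap.ker_eq_bot']
    rintro ⟨α, β⟩ h
    obtain ⟨rfl, rfl⟩ := eq_zero_of_faces hH h
    rfl
  have hr : LinearMap.range D =
      LinearMap.ker (boundary (SideIdx.src (H := H)) SideIdx.tgt) := by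
    apply le_antisymm
    · rintro _ ⟨⟨α, β⟩, rfl⟩
      exact add_mem (hexBoundary_mem hH α) (triBoundary_mem hH β)
    · intro z hz
      obtain ⟨α, β, rfl⟩ := exists_faces_of_cycle hholes hz
      exact ⟨(α, β), rfl⟩
  have h2 := LinearMap.finrank_range_of_inj hD
  rw [hr, Module.finrank_prod, Module.finrank_fintype_fun_eq_card,
    Module.finrank_fintype_fun_eq_card] at h2
  rw [h2] at h1
  simp only [← Nat.card_eq_fintype_card] at h1
  exact h1

end Kagome

/-! ### Counting corners -/

namespace Kagome

variable {H : kagome.Subgraph}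

variable (H) in
/-- The corners of triangles of the tiling that are vertices of the lattice. -/
abbrev Corner : Type := {x : Tri × Fin 3 // x.1.corner x.2 ∈ H.verts}

theorem Side.corner_one {t : Tri} {a : Fin 3} (h : Side H (t, a + 1)) : t.corner a ∈ H.verts := by
  have := h.snd_mem
  simpa only [fin3_one_two] using this

theorem Side.corner_two {t : Tri} {a : Fin 3} (h : Side H (t, a + 2)) : t.corner a ∈ H.verts := by
  have := h.fst_mem
  simpa only [fin3_two_one] using this

/-- Each vertex is a corner of one upward and one downward triangle of the tiling, whether or not
these are faces of the lattice. -/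
theorem corner_bijective (hH : IsLattice H) :
    Function.Bijective fun x : Corner H => ((⟨x.1.1.corner x.1.2, x.2⟩, x.1.1.up) : H.verts × Bool) := by
  constructor
  · rintro ⟨⟨t, a⟩, hx⟩ ⟨⟨t', a'⟩, hx'⟩ h
    rw [Prod.ext_iff] at h
    obtain ⟨h1, h2⟩ := h
    simp only [Subtype.mk.injEq] at h1 h2
    obtain ⟨rfl, rfl | rfl⟩ := Tri.corner_eq_iff.1 h1
    · rfl
    · rw [Tri.opp_up] at h2; simp at h2
  · rintro ⟨p, u⟩
    obtain ⟨t, a, hu, hp⟩ := exists_corner_of_vert hH p u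
    exact ⟨⟨(t, a), by rw [hp]; exact p.2⟩, Prod.ext (Subtype.ext hp) hu⟩

theorem card_corner (hH : IsLattice H) : Nat.card (Corner H) = 2 * Nat.card H.verts := by
  rw [Nat.card_eq_of_bijective _ (corner_bijective hH), Nat.card_prod,
    Nat.card_eq_fintype_card (α := Bool), Fintype.card_bool, mul_comm]

theorem card_side_one :
    Nat.card {x : Corner H // Side H (x.1.1, x.1.2 + 1)} = Nat.card (SideIdx H) := by
  refine Nat.card_eq_of_bijective (fun x => ⟨(x.1.1.1, x.1.1.2 + 1), x.2⟩) ⟨?_, ?_⟩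
  · rintro ⟨⟨⟨t, a⟩, hx⟩, hs⟩ ⟨⟨⟨t', a'⟩, hx'⟩, hs'⟩ h
    simp only [Subtype.mk.injEq, Prod.mk.injEq, add_left_inj] at h
    obtain ⟨rfl, rfl⟩ := h
    rfl
  · rintro ⟨⟨t, k⟩, hs⟩
    have hs' : Side H (t, k + 2 + 1) := by rwa [fin3_two_one]
    exact ⟨⟨⟨(t, k + 2), Side.corner_one hs'⟩, hs'⟩,
      Subtype.ext (Prod.ext rfl (fin3_two_one k))⟩

theorem card_side_two :
    Nat.card {x : Corner H // Side H (x.1.1, x.1.2 + 2)} = Nat.card (SideIdx H) := by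
  refine Nat.card_eq_of_bijective (fun x => ⟨(x.1.1.1, x.1.1.2 + 2), x.2⟩) ⟨?_, ?_⟩
  · rintro ⟨⟨⟨t, a⟩, hx⟩, hs⟩ ⟨⟨⟨t', a'⟩, hx'⟩, hs'⟩ h
    simp only [Subtype.mk.injEq, Prod.mk.injEq, add_left_inj] at h
    obtain ⟨rfl, rfl⟩ := h
    rfl
  · rintro ⟨⟨t, k⟩, hs⟩
    have hs' : Side H (t, k + 1 + 2) := by rwa [fin3_one_two]
    exact ⟨⟨⟨(t, k + 1), Side.corner_two hs'⟩, hs'⟩,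
      Subtype.ext (Prod.ext rfl (fin3_one_two k))⟩

theorem card_face_corner :
    Nat.card {x : Corner H // HasFace H (.tri x.1.1)} = 3 * TF H := by
  have h : Nat.card {x : Corner H // HasFace H (.tri x.1.1)} = Nat.card (TriFace H × Fin 3) := by
    refine Nat.card_eq_of_bijective (fun x => (⟨x.1.1.1, x.2⟩, x.1.1.2)) ⟨?_, ?_⟩
    · rintro ⟨⟨⟨t, a⟩, hx⟩, hs⟩ ⟨⟨⟨t', a'⟩, hx'⟩, hs'⟩ h
      simp only [Subtype.mk.injEq, Prod.mk.injEq] at h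
      obtain ⟨rfl, rfl⟩ := h
      rfl
    · rintro ⟨⟨t, ht⟩, a⟩
      exact ⟨⟨⟨(t, a), Side.corner_one (Side.of_tri ht _)⟩, ht⟩, rfl⟩
  rw [h, Nat.card_prod, Nat.card_eq_fintype_card (α := Fin 3), Fintype.card_fin, mul_comm]
  rfl

/-- The only face at a corner without sides is the opposite triangle. -/
theorem face_of_no_side {t : Tri} {a : Fin 3} (h1 : ¬Side H (t, a + 1)) (h2 : ¬Side H (t, a + 2))
    {f : Face} (hf : HasFace H f) (hp : t.corner a ∈ f.verts) : f = .tri (t.opp a) := by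
  cases f with
  | hex m n =>
    exfalso
    rcases Tri.corner_mem_hex.1 hp with h | h
    · refine h1 (Side.of_hex ?_)
      unfold Tri.hexAt
      rw [← h]; exact hf
    · refine h2 (Side.of_hex ?_)
      unfold Tri.hexAt
      rw [← h]; exact hf
  | tri t' =>
    obtain ⟨b, hb⟩ := hp
    obtain ⟨-, rfl | rfl⟩ := Tri.corner_eq_iff.1 hb
    · exact absurd (Side.of_tri hf _) h1
    · rfl

/-- If a triangle has no side of `H` at a vertex, the only face there can be the opposite triangle,
so the vertex is a triangular corner. Conversely, at a triangular corner it is the triangle opposite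
to the face that has no sides. -/
theorem card_no_side (hH : IsLattice H) :
    Nat.card {x : Corner H // ¬Side H (x.1.1, x.1.2 + 1) ∧ ¬Side H (x.1.1, x.1.2 + 2)} = TC H := by
  unfold TC
  rw [← Nat.card_coe_set_eq]
  refine Nat.card_eq_of_bijective (fun x => ⟨x.1.1.1.corner x.1.1.2, x.1.2, x.1.1.1.opp x.1.1.2,
    ?_, ?_, ?_⟩) ⟨?_, ?_⟩
  · obtain ⟨⟨⟨t, a⟩, hx⟩, h1, h2⟩ := x
    obtain ⟨f, hf, hp⟩ := hH.vert_face _ hx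
    have := face_of_no_side h1 h2 hf hp
    rwa [← this]
  · rw [← Tri.corner_opp]
    exact Tri.corner_mem _ _
  · intro f hf hp
    exact face_of_no_side x.2.1 x.2.2 hf hp
  · rintro ⟨⟨⟨t, a⟩, hx⟩, h1, h2⟩ ⟨⟨⟨t', a'⟩, hx'⟩, h1', h2'⟩ h
    simp only [Subtype.mk.injEq] at h
    obtain ⟨rfl, rfl | rfl⟩ := Tri.corner_eq_iff.1 h
    · rfl
    · exfalso
      obtain ⟨f, hf, hp⟩ := hH.vert_face _ hx'
      have := face_of_no_side h1' h2' hf hp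
      rw [this] at hf
      exact h1 (Side.of_tri hf _)
  · rintro ⟨p, hp, t, ht, ⟨a, rfl⟩, hall⟩
    have key : ∀ q, H.Adj (t.corner a) q → q ∈ (t.opp a).verts → False := by
      intro q hq hqo
      obtain ⟨f, hf, h1, h2⟩ := hH.edge_face _ _ hq
      have := hall f hf h1
      subst this
      refine t.opp_ne a (Tri.eq_of_mem₂ hq.adj_sub.ne ?_ h1 hqo h2)
      rw [← t.corner_opp a]
      exact Tri.corner_mem _ _
    refine ⟨⟨⟨(t.opp a, a), ?_⟩, ?_, ?_⟩, ?_⟩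
    · rw [Tri.corner_opp]; exact hp
    · intro h
      have h : H.Adj ((t.opp a).corner (a + 1 + 1)) ((t.opp a).corner (a + 1 + 2)) := h
      rw [fin3_one_two, Tri.corner_opp] at h
      exact key _ h.symm (Tri.corner_mem _ _)
    · intro h
      have h : H.Adj ((t.opp a).corner (a + 2 + 1)) ((t.opp a).corner (a + 2 + 2)) := h
      rw [fin3_two_one, Tri.corner_opp] at h
      exact key _ h (Tri.corner_mem _ _)
    · exact Subtype.ext (t.corner_opp a)

theorem sum_ite_eq_card {α : Type} [Fintype α] (P : α → Prop) [DecidablePred P] :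
    ∑ x, (if P x then 1 else 0) = Nat.card {x // P x} := by
  rw [Nat.card_eq_fintype_card, Fintype.card_subtype, Finset.card_filter]

/-- Sum the local identity `key` over all corners. Each side has two ends, each triangular face
three corners, each vertex is two corners, and the corners without sides number `TC`. The closure
condition on triangles enters when both sides are present. -/
theorem corner_count (hH : IsLattice H) :
    2 * Nat.card (SideIdx H) + TC H = 3 * TF H + 2 * Nat.card H.verts := by
  classical
  have := hH.finite.to_subtype
  have := Finite.of_injective _ (corner_bijective hH).1
  have := Fintype.ofFinite (Corner H)
  have key : ∀ x : Corner H, (if Side H (x.1.1, x.1.2 + 1) then 1 else 0) +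
      (if Side H (x.1.1, x.1.2 + 2) then 1 else 0) +
      (if ¬Side H (x.1.1, x.1.2 + 1) ∧ ¬Side H (x.1.1, x.1.2 + 2) then 1 else 0) =
      (if HasFace H (.tri x.1.1) then 1 else 0) + 1 := by
    intro x
    by_cases h1 : Side H (x.1.1, x.1.2 + 1)
    · by_cases h2 : Side H (x.1.1, x.1.2 + 2)
      · simp [h1, h2, hasFace_of_two_sides hH (fin3_ne _) h1 h2]
      · have : ¬HasFace H (.tri x.1.1) := fun h => h2 (Side.of_tri h _)
        simp [h1, h2, this]
    · have : ¬HasFace H (.tri x.1.1) := fun h => h1 (Side.of_tri h _)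
      by_cases h2 : Side H (x.1.1, x.1.2 + 2) <;> simp [h1, h2, this]
  have h := Finset.sum_congr (rfl : (Finset.univ : Finset (Corner H)) = Finset.univ)
    fun x _ => key x
  simp only [Finset.sum_add_distrib, sum_ite_eq_card, Finset.sum_const, Finset.card_univ,
    smul_eq_mul, mul_one] at h
  rw [card_side_one, card_side_two, card_face_corner, card_no_side hH, ← Nat.card_eq_fintype_card,
    card_corner hH] at h
  omega

end Kagome

/-! ### The stabilizer group -/

namespace Kagome

open Fermi

variable {H : kagome.Subgraph}

theorem edgeRel (hH : IsLattice H) : EdgeRel H.coe (edgeOp H) where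
  sq h := edgeOp_sq h
  symm h := edgeOp_symm h
  comm h h' h1 h2 h3 h4 := by
    have := edge_edge h h' h1 h2 h3 h4
    rwa [Skew, one_smul] at this
  anti h h' hpr := by
    have := edge_edge_anti hH h h' hpr
    rwa [Skew, op_neg_smul, one_smul] at this

theorem encoding_cycleElt (hH : IsLattice H) {x : H.verts} (w : H.coe.Walk x x) :
    (encoding hH (cycleElt H.coe w) : Op (Qubit H)) = walkOp (edgeOp H) w := by
  have h1 : encoding hH (PresentedGroup.of Gen.phase) = opI := PresentedGroup.toGroup.of _
  have h2 : ∀ d : H.coe.Dart, encoding hH (PresentedGroup.of (Gen.edge d)) =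
      invol (edgeOp H d.fst d.snd) (edgeOp_sq d.adj) := fun d => PresentedGroup.toGroup.of _
  have h3 : ((opI ^ w.length : (Op (Qubit H))ˣ) : Op (Qubit H)) = Complex.I ^ w.length • 1 := by
    rw [Units.val_pow_eq_pow_val]
    simp only [opI, smul_pow, one_pow]
  rw [cycleElt, walkOp, map_mul, map_pow, h1, map_list_prod, List.map_map, Units.val_mul, h3,
    smul_one_mul, ← Units.coeHom_apply, map_list_prod, List.map_map]
  congr 3

theorem stabilizer_eq (hH : IsLattice H) : stabilizer (encoding hH) =
    Subgroup.closure {u : (Op (Qubit H))ˣ | ∃ (x : H.verts) (w : H.coe.Walk x x),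
      (u : Op (Qubit H)) = walkOp (edgeOp H) w} := by
  unfold stabilizer cycleGroup
  rw [MonoidHom.map_closure]
  congr 1
  ext u
  constructor
  · rintro ⟨_, ⟨x, w, rfl⟩, rfl⟩
    exact ⟨x, w, encoding_cycleElt hH w⟩
  · rintro ⟨x, w, h⟩
    exact ⟨_, ⟨x, w, rfl⟩, Units.ext ((encoding_cycleElt hH w).trans h.symm)⟩

theorem triOf_corner (t : Tri) {a b : Fin 3} (h : a ≠ b) :
    triOf (t.corner a) (t.corner b) = t := by
  have hadj := t.adj_corner h
  obtain ⟨h1, h2⟩ := triOf_spec hadj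
  exact Tri.eq_of_mem₂ hadj.ne h1 (t.corner_mem a) h2 (t.corner_mem b)

theorem edgeSign_corner (t : Tri) (a : Fin 3) :
    edgeSign (t.corner a) (t.corner (a + 1)) = 1 := by
  have h : a ≠ a + 1 := by revert a; decide
  unfold edgeSign
  rw [triOf_corner t h, if_pos ⟨a, rfl, rfl⟩]

theorem facePauli_corner (t : Tri) : facePauli (t.corner 1) (t.corner 2) = .X ∧
    facePauli (t.corner 2) (t.corner 0) = .Y ∧ facePauli (t.corner 0) (t.corner 1) = .Z := by
  rcases t.sgn_eq with ⟨-, hs⟩ | ⟨-, hs⟩ <;>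
    simp [facePauli, Tri.corner_zero, Tri.corner_one, Tri.corner_two, hs]

theorem pauli_mul_XYZ : Pauli.X.mat * Pauli.Y.mat * Pauli.Z.mat = Complex.I • 1 := by
  ext i j
  fin_cases i <;> fin_cases j <;> simp [Pauli.mat]

/-- The edge operators around a triangular face multiply to a phase. -/
theorem tri_edgeOp {t : Tri} (ht : HasFace H (.tri t)) (p : Fin 3 → H.verts)
    (hp : ∀ a, (p a : ℤ × ℤ) = t.corner a) :
    edgeOp H (p 1) (p 2) * edgeOp H (p 2) (p 0) * edgeOp H (p 0) (p 1) = Complex.I • 1 := by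
  have aux : ∀ {P : Pauli} (s : Tri) (hs : HasFace H (.tri s)), s = t →
      opOn (Sum.inr ⟨s, hs⟩ : Qubit H) P.mat = opOn (Sum.inr ⟨t, ht⟩) P.mat := by
    rintro P s hs rfl; rfl
  have hf : ∀ a b, a ≠ b → faceOp H (p a) (p b) =
      opOn (Sum.inr ⟨t, ht⟩) (facePauli (t.corner a) (t.corner b)).mat := by
    intro a b h
    have h1 : triOf (p a : ℤ × ℤ) (p b) = t := by rw [hp, hp, triOf_corner t h]
    have h2 : HasFace H (.tri (triOf (p a : ℤ × ℤ) (p b))) := h1 ▸ ht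
    unfold faceOp
    rw [dif_pos h2, aux _ h2 h1, hp, hp]
  have hP : ∀ a b, a ≠ b → endPauli (p a) (p b) = if t.up then .X else .Y := by
    intro a b h
    unfold endPauli
    rw [hp, hp, triOf_corner t h]
  obtain ⟨f1, f2, f3⟩ := facePauli_corner t
  unfold edgeOp
  rw [hf 1 2 (by decide), hf 2 0 (by decide), hf 0 1 (by decide), f1, f2, f3,
    hP 1 2 (by decide), hP 2 0 (by decide), hP 0 1 (by decide)]
  simp only [hp]
  rw [show edgeSign (t.corner 1) (t.corner 2) = 1 from edgeSign_corner t 1,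
    show edgeSign (t.corner 2) (t.corner 0) = 1 from edgeSign_corner t 2,
    show edgeSign (t.corner 0) (t.corner 1) = 1 from edgeSign_corner t 0, one_smul, one_smul,
    one_smul]
  generalize (if t.up then Pauli.X else Pauli.Y) = P
  have hr : ∀ a (R : Pauli), opOn (Sum.inr ⟨t, ht⟩ : Qubit H) R.mat * opOn (Sum.inl (p a)) P.mat =
      opOn (Sum.inl (p a)) P.mat * opOn (Sum.inr ⟨t, ht⟩) R.mat := fun a R =>
    opOn_comm (by simp) _ _
  have hs : ∀ a, opOn (Sum.inl (p a) : Qubit H) P.mat * opOn (Sum.inl (p a)) P.mat = 1 :=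
    fun a => opOn_sq _ _
  have hxyz : opOn (Sum.inr ⟨t, ht⟩ : Qubit H) Pauli.X.mat *
      opOn (Sum.inr ⟨t, ht⟩) Pauli.Y.mat * opOn (Sum.inr ⟨t, ht⟩) Pauli.Z.mat = Complex.I • 1 := by
    rw [opOn_mul, opOn_mul, pauli_mul_XYZ, opOn_smul, opOn_one]
  have r0 := hr 0
  have r1 := hr 1
  have r2 := hr 2
  have s0 := hs 0
  have s1 := hs 1
  have s2 := hs 2
  generalize opOn (Sum.inl (p 0) : Qubit H) P.mat = x0 at *
  generalize opOn (Sum.inl (p 1) : Qubit H) P.mat = x1 at *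
  generalize opOn (Sum.inl (p 2) : Qubit H) P.mat = x2 at *
  have rX2 := r2 .X
  have rX0 := r0 .X
  have rY0 := r0 .Y
  have rX1 := r1 .X
  have rY1 := r1 .Y
  generalize opOn (Sum.inr ⟨t, ht⟩ : Qubit H) Pauli.X.mat = X at *
  generalize opOn (Sum.inr ⟨t, ht⟩ : Qubit H) Pauli.Y.mat = Y at *
  generalize opOn (Sum.inr ⟨t, ht⟩ : Qubit H) Pauli.Z.mat = Z at *
  -- Each vertex Pauli occurs twice and cancels, since it commutes with the face qubit; what remains
  -- is `XYZ` on the face qubit.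
  calc x1 * x2 * X * (x2 * x0 * Y) * (x0 * x1 * Z)
      = x1 * x2 * (X * x2) * x0 * (Y * x0) * x1 * Z := by simp only [mul_assoc]
    _ = x1 * (x2 * x2) * (X * x0) * x0 * (Y * x1) * Z := by
        rw [rX2, rY0]; simp only [mul_assoc]
    _ = x1 * x0 * X * x0 * (x1 * Y) * Z := by
        rw [s2, rY1, rX0]; simp only [mul_assoc, one_mul]
    _ = x1 * x0 * (X * x0) * (x1 * Y) * Z := by simp only [mul_assoc]
    _ = x1 * (x0 * x0) * (X * x1) * Y * Z := by rw [rX0]; simp only [mul_assoc]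
    _ = (x1 * x1) * (X * Y * Z) := by rw [s0, rX1]; simp only [mul_assoc, mul_one]
    _ = Complex.I • 1 := by rw [s1, hxyz, one_mul]

theorem fin3_trichotomy (k a : Fin 3) : k = a ∨ k = a + 1 ∨ k = a + 2 := by revert k a; decide

theorem fin3_add_one_ne (a : Fin 3) : a + 1 ≠ a := by revert a; decide

theorem fin3_add_two_ne (a : Fin 3) : a + 2 ≠ a := by revert a; decide

/-- The Pauli that commutes with the edge operators at a vertex, except those on triangles of the
same orientation as `t`. -/
def Tri.test (t : Tri) : Pauli := if t.up then .Y else .X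

theorem skew_end {x y : H.verts} {P R : Pauli} (h : x = y) (hPR : P ≠ R) :
    Skew (-1) (opOn (Sum.inl x : Qubit H) P.mat) (opOn (Sum.inl y) R.mat) := by
  subst h; exact skew_anti _ hPR

theorem skew_end_self (x y : H.verts) (P : Pauli) :
    Skew 1 (opOn (Sum.inl x : Qubit H) P.mat) (opOn (Sum.inl y) P.mat) := by
  by_cases h : x = y
  · subst h; exact skew_self _
  · exact skew_inl h _ _

-- The test Pauli differs from the end Pauli only on triangles oriented like `t`. Among their sides,
-- exactly the two sides of `t` at its corner `a` touch the tested vertex, each at one end.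
open Classical in
theorem skew_edge_test (i : SideIdx H) (t : Tri) (a : Fin 3) (hp : t.corner a ∈ H.verts) :
    Skew (if i.1.1 = t ∧ i.1.2 ≠ a then -1 else 1) (edgeOp H i.src i.tgt)
      (opOn (Sum.inl ⟨t.corner a, hp⟩) t.test.mat) := by
  obtain ⟨⟨t', k⟩, hi⟩ := i
  have hP : endPauli (SideIdx.src ⟨(t', k), hi⟩) (SideIdx.tgt ⟨(t', k), hi⟩) =
      if t'.up then .X else .Y := by
    unfold endPauli
    rw [show triOf (SideIdx.src ⟨(t', k), hi⟩ : ℤ × ℤ) (SideIdx.tgt ⟨(t', k), hi⟩) = t' from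
      triOf_corner t' (fin3_ne k)]
  have hsrc : (SideIdx.src ⟨(t', k), hi⟩ = ⟨t.corner a, hp⟩) ↔
      k + 1 = a ∧ (t' = t ∨ t' = t.opp a) := by
    rw [Subtype.ext_iff]
    exact Tri.corner_eq_iff (t := t) (t' := t') (a := a) (b := k + 1)
  have htgt : (SideIdx.tgt ⟨(t', k), hi⟩ = ⟨t.corner a, hp⟩) ↔
      k + 2 = a ∧ (t' = t ∨ t' = t.opp a) := by
    rw [Subtype.ext_iff]
    exact Tri.corner_eq_iff (t := t) (t' := t') (a := a) (b := k + 2)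
  generalize SideIdx.src ⟨(t', k), hi⟩ = x at *
  generalize SideIdx.tgt ⟨(t', k), hi⟩ = y at *
  have hface := skew_face_inl (H := H) ⟨t.corner a, hp⟩ x y t.test.mat
  by_cases hup : t'.up = t.up
  · have hanti : endPauli x y ≠ t.test := by
      rw [hP, hup]; unfold Tri.test; cases t.up <;> simp
    by_cases ht : t' = t
    · rcases fin3_trichotomy k a with h | h | h
      · have e1 : x ≠ ⟨t.corner a, hp⟩ := fun e =>
          fin3_add_one_ne a (by rw [← h, (hsrc.1 e).1, h])
        have e2 : y ≠ ⟨t.corner a, hp⟩ := fun e =>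
          fin3_add_two_ne a (by rw [← h, (htgt.1 e).1, h])
        rw [if_neg (fun e => e.2 h)]
        exact skew_edge (skew_inl e1 _ _) (skew_inl e2 _ _) hface (by norm_num)
      · have e1 : x ≠ ⟨t.corner a, hp⟩ := fun e =>
          fin3_add_two_ne a (by rw [← fin3_one_one, ← h, (hsrc.1 e).1])
        have e2 : y = ⟨t.corner a, hp⟩ := htgt.2 ⟨by rw [h, fin3_one_two], Or.inl ht⟩
        rw [if_pos ⟨ht, fun e => fin3_add_one_ne a (h.symm.trans e)⟩]
        exact skew_edge (skew_inl e1 _ _) (skew_end e2 hanti) hface (by norm_num)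
      · have e1 : x = ⟨t.corner a, hp⟩ := hsrc.2 ⟨by rw [h, fin3_two_one], Or.inl ht⟩
        have e2 : y ≠ ⟨t.corner a, hp⟩ := fun e =>
          fin3_add_one_ne a (by rw [← fin3_two_two, ← h, (htgt.1 e).1])
        rw [if_pos ⟨ht, fun e => fin3_add_two_ne a (h.symm.trans e)⟩]
        exact skew_edge (skew_end e1 hanti) (skew_inl e2 _ _) hface (by norm_num)
    · have hopp : ¬t' = t.opp a := fun e => by
        rw [e, Tri.opp_up] at hup; simp at hup
      have e1 : x ≠ ⟨t.corner a, hp⟩ := fun e => (hsrc.1 e).2.elim ht hopp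
      have e2 : y ≠ ⟨t.corner a, hp⟩ := fun e => (htgt.1 e).2.elim ht hopp
      rw [if_neg (fun e => ht e.1)]
      exact skew_edge (skew_inl e1 _ _) (skew_inl e2 _ _) hface (by norm_num)
  · have hP' : endPauli x y = t.test := by
      rw [hP]; unfold Tri.test; revert hup; cases t.up <;> cases t'.up <;> simp
    rw [if_neg (fun e => hup (by rw [← e.1]))]
    rw [← hP'] at hface ⊢
    exact skew_edge (skew_end_self _ _ _) (skew_end_self _ _ _) hface (by norm_num)

open Classical in
theorem edgeOp_test (i : SideIdx H) (t : Tri) (a : Fin 3)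
    (hp : t.corner a ∈ H.verts) :
    edgeOp H i.src i.tgt * opOn (Sum.inl ⟨t.corner a, hp⟩) t.test.mat =
      (if ((if i.1 = (t, a + 1) then 1 else 0) + (if i.1 = (t, a + 2) then 1 else 0) : ZMod 2) = 0
        then 1 else -1 : Op (Qubit H)) *
      (opOn (Sum.inl ⟨t.corner a, hp⟩) t.test.mat * edgeOp H i.src i.tgt) := by
  have h := skew_edge_test i t a hp
  have hind : ((if i.1 = (t, a + 1) then 1 else 0) + (if i.1 = (t, a + 2) then 1 else 0) : ZMod 2) =
      if i.1.1 = t ∧ i.1.2 ≠ a then 1 else 0 := by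
    simp only [Prod.ext_iff]
    by_cases ht : i.1.1 = t
    · rcases fin3_trichotomy i.1.2 a with h1 | h1 | h1 <;> simp [ht, h1]
    · simp [ht]
  rw [hind]
  by_cases hc : i.1.1 = t ∧ i.1.2 ≠ a
  · rw [if_pos hc, Skew, op_neg_smul, one_smul] at h
    rw [if_pos hc, if_neg one_ne_zero, op_neg_one_mul]
    exact h
  · rw [if_neg hc, Skew, one_smul] at h
    rw [if_neg hc, if_pos rfl, one_mul]
    exact h

end Kagome

/-! ### The kernel on cycles, and the rank of the stabilizer group. -/

namespace Kagome

open Fermi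

variable {H : kagome.Subgraph}

theorem triBoundary_single [DecidableEq (TriFace H)] [DecidableEq (SideIdx H)] (t : TriFace H) :
    triBoundary H (Pi.single t 1) = Pi.single ⟨(t.1, 0), Side.of_tri t.2 0⟩ 1 +
      Pi.single ⟨(t.1, 1), Side.of_tri t.2 1⟩ 1 + Pi.single ⟨(t.1, 2), Side.of_tri t.2 2⟩ 1 := by
  funext i
  obtain ⟨⟨t', k⟩, hi⟩ := i
  change extZero (fun t => HasFace H (.tri t)) (Pi.single t 1) t' = _
  by_cases ht : t' = t.1
  · subst ht
    rw [extZero_pos (P := fun t => HasFace H (.tri t)) _ t.2]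
    simp only [Subtype.coe_eta, Pi.single_eq_same, Pi.add_apply, Pi.single_apply,
      Subtype.mk.injEq, Prod.mk.injEq, true_and]
    fin_cases k <;> simp
  · have h1 : extZero (fun t => HasFace H (.tri t)) (Pi.single t 1) t' = 0 := by
      by_cases h : HasFace H (.tri t')
      · rw [extZero_pos (P := fun t => HasFace H (.tri t)) _ h, Pi.single_eq_of_ne]
        exact fun e => ht (congrArg Subtype.val e)
      · exact extZero_neg (P := fun t => HasFace H (.tri t)) _ h
    simp [h1, ht]

/-- A chain whose sides at every corner of a triangle agree is a sum of triangular faces. -/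
theorem exists_triBoundary {z : SideIdx H → ZMod 2}
    (hz : ∀ (t : Tri) (a : Fin 3), t.corner a ∈ H.verts →
      extZero (Side H) z (t, a + 1) + extZero (Side H) z (t, a + 2) = 0) :
    ∃ β, z = triBoundary H β := by
  have h1 : ∀ t a, extZero (Side H) z (t, a + 1) = extZero (Side H) z (t, a + 2) := by
    intro t a
    by_cases hp : t.corner a ∈ H.verts
    · rw [← sub_eq_zero, CharTwo.sub_eq_add]; exact hz t a hp
    · rw [extZero_neg _ fun h => hp (Side.corner_one h),
        extZero_neg _ fun h => hp (Side.corner_two h)]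
  have h2 : ∀ t k, extZero (Side H) z (t, k) = extZero (Side H) z (t, 0) := by
    intro t k
    have e1 := h1 t 1
    have e2 := h1 t 2
    fin_cases k
    · rfl
    · exact e2.symm
    · exact e1
  refine ⟨fun t => extZero (Side H) z (t.1, 0), ?_⟩
  funext i
  change z i = extZero (fun t : Tri => HasFace H (.tri t))
    (fun t => extZero (Side H) z (t.1, 0)) i.1.1
  rw [← extZero_pos z i.2, h2]
  by_cases ht : HasFace H (.tri i.1.1)
  · rw [extZero_pos (P := fun t => HasFace H (.tri t)) _ ht]
  · rw [extZero_neg (P := fun t => HasFace H (.tri t)) _ ht]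
    by_contra h
    -- A nonzero value on one side is shared by all three, so all three belong to `H`.
    refine ht (hasFace_tri_iff.2 fun k => of_extZero_ne_zero (φ := z) ?_)
    rw [h2]; exact h

/-- The stabilizer group does not contain `-1`, and its rank is the number of hexagons. -/
theorem stabilizer_spec (hH : IsLattice H) (hconn : H.Connected) (hholes : NoHoles H) :
    -1 ∉ stabilizer (encoding hH) ∧ minGen (stabilizer (encoding hH)) = HF H := by
  classical
  have := hH.finite.to_subtype
  have := finite_sideIdx hH
  have := finite_hexFace hH
  have := finite_triFace hH
  have := Fintype.ofFinite H.verts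
  have := Fintype.ofFinite (SideIdx H)
  have := Fintype.ofFinite (HexFace H)
  have := Fintype.ofFinite (TriFace H)
  obtain ⟨f, hrange, htest, htri⟩ := exists_cycle_hom (edgeRel hH) hconn.coe SideIdx.adj
    exists_sideIdx (stabilizer (encoding hH)) (stabilizer_eq hH)
    (fun x w => ⟨encoding hH (cycleElt _ w), encoding_cycleElt hH w⟩)
  let hb : (HexFace H → ZMod 2) →ₗ[ZMod 2]
      LinearMap.ker (boundary (SideIdx.src (H := H)) SideIdx.tgt) :=
    (hexBoundary H).codRestrict _ (hexBoundary_mem hH)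
  let tb : (TriFace H → ZMod 2) →ₗ[ZMod 2]
      LinearMap.ker (boundary (SideIdx.src (H := H)) SideIdx.tgt) :=
    (triBoundary H).codRestrict _ (triBoundary_mem hH)
  -- By additivity one triangle is enough, and there the phase `i ^ 3` of the closed walk meets `XYZ
  -- = i`.
  have htb : ∀ β, f (Multiplicative.ofAdd (tb β)) = 1 := by
    intro β
    let N : AddSubgroup (TriFace H → ZMod 2) :=
      (Subgroup.toAddSubgroup' f.ker).comap tb.toAddMonoidHom
    have hN : ∀ β, β ∈ N ↔ f (Multiplicative.ofAdd (tb β)) = 1 := fun β => Iff.rfl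
    rw [← hN, ← Finset.univ_sum_single β]
    refine sum_mem fun t _ => ?_
    have h01 : ∀ y : ZMod 2, y = 0 ∨ y = 1 := by decide
    rcases h01 (β t) with h | h <;> rw [h]
    · rw [Pi.single_zero]; exact zero_mem _
    · rw [hN]
      have h1 := htri ⟨(t.1, 0), Side.of_tri t.2 0⟩ ⟨(t.1, 1), Side.of_tri t.2 1⟩
        ⟨(t.1, 2), Side.of_tri t.2 2⟩ rfl rfl rfl (tb (Pi.single t 1)) (triBoundary_single t)
      refine Units.ext (h1.trans ?_)
      have hv : ∀ a : Fin 3, t.1.corner a ∈ H.verts := fun a =>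
        Side.corner_one (Side.of_tri t.2 _)
      have h2 := tri_edgeOp t.2 (fun a => ⟨t.1.corner a, hv a⟩) fun a => rfl
      refine (congrArg (fun x => Complex.I ^ 3 • x) h2).trans ?_
      simp only [smul_smul]
      rw [← pow_succ, Complex.I_pow_four, one_smul]
      rfl
  -- Test with a Pauli at each corner of each triangle: the pairing is then the sum of `z` over the
  -- two sides of the triangle at that corner.
  have hcentral : ∀ z : LinearMap.ker (boundary (SideIdx.src (H := H)) SideIdx.tgt),
      (∀ X : (Op (Qubit H))ˣ, (f (Multiplicative.ofAdd z) : Op (Qubit H)) * X =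
        X * f (Multiplicative.ofAdd z)) → ∃ β, z = tb β := by
    intro z hz
    obtain ⟨β, hβ⟩ := exists_triBoundary (z := z.1) (fun t a hp => by
      have h1 := htest (invol (opOn (Sum.inl ⟨t.corner a, hp⟩) t.test.mat) (opOn_sq _ _))
        (fun i => (if i.1 = (t, a + 1) then 1 else 0) + (if i.1 = (t, a + 2) then 1 else 0))
        (fun i => edgeOp_test i t a hp) z (hz _)
      simpa only [mul_add, Finset.sum_add_distrib, sum_ite_eq_extZero] using h1)
    exact ⟨β, Subtype.ext hβ⟩
  constructor
  · intro h
    rw [← hrange] at h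
    obtain ⟨z, hz⟩ := h
    obtain ⟨β, hβ⟩ := hcentral z.toAdd fun X => by
      change (f z : Op (Qubit H)) * X = X * f z
      rw [hz]; simp
    have h1 : f z = 1 := by
      have := htb β
      rwa [← hβ] at this
    rw [h1] at hz
    have h2 : (1 : Op (Qubit H)) = -1 := congrArg Units.val hz
    have h3 := congrFun (LinearMap.congr_fun h2 fun _ => (1 : ℂ)) fun _ => 0
    simp only [Module.End.one_apply, LinearMap.neg_apply, Pi.neg_apply] at h3
    norm_num at h3
  · let g : Multiplicative (HexFace H → ZMod 2) →* (Op (Qubit H))ˣ :=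
      f.comp (AddMonoidHom.toMultiplicative hb.toAddMonoidHom)
    have hg : ∀ α, g (Multiplicative.ofAdd α) = f (Multiplicative.ofAdd (hb α)) := fun α => rfl
    -- A sum of hexagons acting as `1` would equal a sum of triangles, which independence of the
    -- faces excludes unless it is empty.
    have hinj : Function.Injective g := by
      rw [injective_iff_map_eq_one]
      intro α hα
      have h1 : f (Multiplicative.ofAdd (hb α.toAdd)) = 1 := hα
      obtain ⟨β, hβ⟩ := hcentral (hb α.toAdd) fun X => by rw [h1]; simp
      have h2 : hexBoundary H α.toAdd = triBoundary H β := congrArg Subtype.val hβ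
      have h3 : hexBoundary H α.toAdd + triBoundary H (-β) = 0 := by
        rw [map_neg, ← h2, add_neg_cancel]
      exact (eq_zero_of_faces hH h3).1
    have hgr : g.range = stabilizer (encoding hH) := by
      rw [← hrange]
      apply le_antisymm
      · rintro _ ⟨α, rfl⟩
        exact ⟨_, rfl⟩
      · rintro _ ⟨z, rfl⟩
        obtain ⟨α, β, h⟩ := exists_faces_of_cycle hholes z.toAdd.2
        refine ⟨Multiplicative.ofAdd α, ?_⟩
        have hz : z = Multiplicative.ofAdd (hb α) * Multiplicative.ofAdd (tb β) :=
          Subtype.ext h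
        rw [hz, map_mul, htb, mul_one, hg]
    rw [← hgr, minGen_range g hinj, ← Nat.card_eq_fintype_card]
    rfl

end Kagome

theorem mainTheorem7 (H : Kagome.kagome.Subgraph) (hH : Kagome.IsLattice H)
    (hconn : H.Connected) (hholes : Kagome.NoHoles H) :
    (-1 ∉ Fermi.stabilizer (Kagome.encoding hH)) ∧
    (Fermi.disparity (Kagome.encoding hH) : ℚ) =
      (Kagome.HF H : ℚ) + (Kagome.TC H : ℚ) - 2 ∧
    (Fermi.disparity (Kagome.encoding hH) : ℚ) =
      1 / 2 * ((Kagome.TF H : ℚ) + (Kagome.TC H : ℚ) - 2) := by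
  obtain ⟨h1, h2⟩ := Kagome.stabilizer_spec hH hconn hholes
  have e1 := Kagome.euler hH hconn hholes
  have e2 := Kagome.corner_count hH
  have h3 : Fermi.disparity (Kagome.encoding hH) = (Kagome.TF H : ℤ) - Kagome.HF H := by
    have := hH.finite.to_subtype
    have := Kagome.finite_triFace hH
    have h4 : Nat.card (Kagome.Qubit H) = Nat.card H.verts + Kagome.TF H := Nat.card_sum
    unfold Fermi.disparity
    rw [h2, h4]
    push_cast
    ring
  -- Twice Euler's formula combined with the corner count eliminates the vertices and edges.
  have h5 : Kagome.TF H + 2 = 2 * Kagome.HF H + Kagome.TC H := by omega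
  have h6 : (Kagome.TF H : ℚ) + 2 = 2 * Kagome.HF H + Kagome.TC H := by exact_mod_cast h5
  refine ⟨h1, ?_, ?_⟩ <;> rw [h3] <;> push_cast <;> linarith
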